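/- All graphs are finite and simple. For a graph $G$ with vertices $v_1,\dots,v_n$ and edges $e_1,\dots,e_m$, a graph $H_1$ on $\{v_1,\dots,v_n\}$ and a graph $H_2$ with vertices $w_1,\dots,w_m$, let $[S(G)]^{H_1}_{H_2}$ be the graph obtained from the subdivision graph $S(G)$ (a new vertex is inserted into every edge of $G$) by joining $v_i$ and $v_j$ whenever they are adjacent in $H_1$, and joining the new vertices on $e_s$ and $e_t$ whenever $w_s$ and $w_t$ are adjacent in $H_2$. Write $[S(G)]^{H}=[S(G)]^{H}_{\overline{K_m}}$ and $[S(G)]_{H}=[S(G)]^{\overline{K_n}}_{H}$. Let $\mathcal L(G)$ be the line graph, $\overline{\phantom{G}}$ the complement and $L(G)$ the Laplacian matrix. For a connected graph, the Kirchhoff index $Kf=\sum_{i<j}r_{ij}$ is the sum, over unordered pairs of vertices, of the effective resistances when every edge is a unit resistor. Let $G$ be an $r$-regular graph with $n\ge 1$ vertices and $m$ edges, and let $H$ be a graph on the same vertex set whose adjacency matrix commutes with that of $G$. Then there is an orthonormal basis $x_1,\dots,x_n$ of $\mathbb R^n$ with $L(G)x_i=\mu_i(G)x_i$ and $L(H)x_i=\mu_i(H)x_i$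 for all $i$, and $\mu_1(G)=\mu_1(H)=0$. For every such basis, with $k_1=m+n$, $k_2=r+2$ and $k_3=m-2r+2$, each of the following formulas holds whenever the graph on its left-hand side is connected: (1) $\displaystyle Kf\left([S(G)]^{H}\right)=\frac n2+\frac{m^2-n^2}{2}+k_1\sum_{i=2}^{n}\frac{k_2+\mu_i(H)}{2\mu_i(H)+\mu_i(G)}$; (2) $\displaystyle Kf\left([S(G)]^{H}_{K_m}\right)=\frac n2+\frac{m^2-n^2}{m+2}+k_1\sum_{i=2}^{n}\frac{m+k_2+\mu_i(H)}{m(r+\mu_i(H))+2\mu_i(H)+\mu_i(G)}$; (3) $\displaystyle Kf\left([S(G)]^{H}_{\overline{\mathcal L(G)}}\right)=\frac n2+\frac{m^2-n^2}{k_3}+k_1\sum_{i=2}^{n}\frac{m+k_2+\mu_i(H)-\mu_i(G)}{[m-\mu_i(G)][r+\mu_i(H)]+2\mu_i(H)+\mu_i(G)}$. (4) Let $m\ge 1$, let $H$ be any graph with $m$ vertices, and let $\mu_1(H)=0,\mu_2(H),\dots,\mu_m(H)$ be its Laplacian eigenvalues with multiplicity. Then, for every labelling of the edges of the star $K_{1,m}$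 by the vertices of $H$, $$Kf\left([S(K_{1,m})]_H\right)=m+3+(2m+1)\sum_{j=2}^{m}\frac{\mu_j(H)+3}{\mu_j(H)+1}.$$ -/

import Mathlib

/-- The `(H₁, H₂)`-merged subdivision graph `[S(G)]^{H₁}_{H₂}`.  The old vertices are the vertices
of `G`, the new vertex lying on the edge `e` of `G` is `e` itself; `H₁` is a graph on the vertices
of `G` and `H₂` is a graph on the edges of `G`.  The edges between old and new vertices are those
of the subdivision graph `S(G)`. -/
def mergedSubdivision {V : Type*} (G H₁ : SimpleGraph V) (H₂ : SimpleGraph G.edgeSet) :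
    SimpleGraph (V ⊕ G.edgeSet) where
  Adj
    | .inl u, .inl v => H₁.Adj u v
    | .inl v, .inr e => v ∈ (e : Sym2 V)
    | .inr e, .inl v => v ∈ (e : Sym2 V)
    | .inr e, .inr f => H₂.Adj e f
  symm := ⟨by
    rintro (u | e) (v | f) h
    · exact SimpleGraph.Adj.symm (G := H₁) h
    · exact h
    · exact h
    · exact SimpleGraph.Adj.symm (G := H₂) h⟩
  loopless := ⟨by
    rintro (u | e) h
    · exact H₁.loopless.irrefl u h
    · exact H₂.loopless.irrefl e h⟩

open Classical in
/-- `p` is the electric potential in the network with a unit resistor on each edge of `G` when a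
unit current enters at `a` and leaves at `b`: by Ohm's law the current from `v` to a neighbour `w`
is `p v - p w`, and by Kirchhoff's current law the net current out of `v` is the current injected
at `v`. -/
def IsUnitCurrentPotential {V : Type*} [Fintype V] (G : SimpleGraph V) (a b : V)
    (p : V → ℝ) : Prop :=
  ∀ v : V, ∑ w ∈ G.neighborFinset v, (p v - p w) =
    (if v = a then 1 else 0) - (if v = b then 1 else 0)

open Classical in
/-- The resistance distance (effective resistance) between `a` and `b`: the potential difference
`p a - p b` that drives a unit current from `a` to `b`.  In a connected graph the potential `p`
exists and is unique up to an additive constant; without a potential the value is `0`. -/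
noncomputable def resistanceDistance {V : Type*} [Fintype V] (G : SimpleGraph V) (a b : V) : ℝ :=
  if h : ∃ p : V → ℝ, IsUnitCurrentPotential G a b p then h.choose a - h.choose b else 0

/-- The Kirchhoff index: the sum of the resistance distances over all unordered pairs of vertices,
written as half of the sum over all ordered pairs (the diagonal terms vanish). -/
noncomputable def kirchhoffIndex {V : Type*} [Fintype V] (G : SimpleGraph V) : ℝ :=
  (∑ a : V, ∑ b : V, resistanceDistance G a b) / 2

/-- In a connected graph the resistance distance does not depend on the choice of potential. -/
theorem resistanceDistance_eq {V : Type*} [Fintype V] {G : SimpleGraph V} (hG : G.Connected)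
    {a b : V} {p : V → ℝ} (hp : IsUnitCurrentPotential G a b p) :
    resistanceDistance G a b = p a - p b := by
  classical
  have h : ∃ p : V → ℝ, IsUnitCurrentPotential G a b p := ⟨p, hp⟩
  have hq := h.choose_spec
  rw [resistanceDistance, dif_pos h]
  set q := h.choose
  have key : (G.lapMatrix ℝ).mulVec (q - p) = 0 := by
    funext v
    have h1 := hp v
    have h2 := hq v
    rw [← h1] at h2
    rw [SimpleGraph.lapMatrix_mulVec_apply]
    simp only [Finset.sum_sub_distrib, Finset.sum_const, SimpleGraph.card_neighborFinset_eq_degree,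
      nsmul_eq_mul, Pi.sub_apply, Pi.zero_apply] at h2 ⊢
    linear_combination h2
  have := (G.lapMatrix_mulVec_eq_zero_iff_forall_reachable (x := q - p)).1 key a b
    (hG.preconnected a b)
  simp only [Pi.sub_apply] at this
  linarith

/-- `μG` and `μH` list the Laplacian eigenvalues of the graphs `G` and `H` on the same `n` vertices
(with multiplicity) in a common order: the `i`-th eigenvalues of `G` and of `H` belong to the same
vector `x i` of a common orthonormal eigenbasis, and the `0`-th eigenvalues are both `0`. -/
def IsJointLaplacianSpectrum {V : Type*} [Fintype V] [DecidableEq V] (G H : SimpleGraph V)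
    [DecidableRel G.Adj] [DecidableRel H.Adj] {n : ℕ} [NeZero n] (μG μH : Fin n → ℝ) : Prop :=
  μG 0 = 0 ∧ μH 0 = 0 ∧
    ∃ x : OrthonormalBasis (Fin n) ℝ (EuclideanSpace ℝ V), ∀ i : Fin n,
      (G.lapMatrix ℝ).mulVec (x i).ofLp = μG i • (x i).ofLp ∧
      (H.lapMatrix ℝ).mulVec (x i).ofLp = μH i • (x i).ofLp

/-- `μ` lists the Laplacian eigenvalues of the graph `H` on `m` vertices (with multiplicity), the
`0`-th one being `0`. -/
def IsLaplacianSpectrum {V : Type*} [Fintype V] [DecidableEq V] (H : SimpleGraph V)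
    [DecidableRel H.Adj] {m : ℕ} [NeZero m] (μ : Fin m → ℝ) : Prop :=
  μ 0 = 0 ∧ (H.lapMatrix ℝ).charpoly = ∏ i : Fin m, (Polynomial.X - Polynomial.C (μ i))

/-! If `L * M = 1 - c 1ᵀ` for the Laplacian `L` of a connected graph on `N` vertices, then the
difference of columns `a` and `b` of `M` is a unit current potential, and summing resistances gives
`Kf = N tr M - ∑ M a b`. So every formula reduces to one explicit `M`, its trace and its entry sum.

For regular `G` with vertex-edge incidence matrix `B`, the Laplacian has blocks `r + L(H)`, `-B`,
`-Bᵀ` and `2 + L(H₂)`. Here `B Bᵀ = 2r - L(G)`, and for the three choices of `H₂` the last block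
lies in the span of `1`, `J` and `Bᵀ B`. The commuting matrices `L(G)`, `L(H)`, `J` are
simultaneously diagonal: they are values of one algebra homomorphism `φ` from functions on the
eigenbasis, with `J = φ(n e₀)`. Since columns of `B` sum to 2, the all-ones matrix on edges is `Bᵀ J
B / 4`. An `M` with blocks `φ s`, `φ g B`, `Bᵀ φ g`, `α⁻¹ + Bᵀ φ h B` then turns the matrix identity
into scalar equations for each eigenvector. Off index 0 these have determinant `Δ i`, nonzero by
connectedness; index 0 is solved by hand.

The star is not regular. There the centre is grounded: the remaining Laplacian has blocks `1`, `-Z`,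
`-Zᵀ`, `2 + L(H)` with `Z` a bijection matrix between leaves and edges, so its Schur complement is
`1 + L(H)`, whose inverse has trace `∑ 1/(μ j + 1)`. -/

/-! ### Resistances from generalized inverses -/

open Matrix in
theorem isUnitCurrentPotential_iff_lapMatrix_mulVec {V : Type*} [Fintype V] [DecidableEq V]
    (Γ : SimpleGraph V) [DecidableRel Γ.Adj] (a b : V) (p : V → ℝ) :
    IsUnitCurrentPotential Γ a b p ↔
      Γ.lapMatrix ℝ *ᵥ p = fun v => (if v = a then 1 else 0) - (if v = b then 1 else 0) := by
  rw [IsUnitCurrentPotential, funext_iff]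
  refine forall_congr' fun v => ?_
  rw [SimpleGraph.lapMatrix_mulVec_apply, Finset.sum_sub_distrib, Finset.sum_const,
    SimpleGraph.card_neighborFinset_eq_degree, nsmul_eq_mul]
  have h1 : ∀ x : V, @ite ℝ (v = x) (Classical.propDecidable _) 1 0 = if v = x then 1 else 0 :=
    fun x => by congr
  rw [h1, h1]
  convert Iff.rfl

open Matrix in
/-- The Kirchhoff index of a connected graph, computed from a generalized inverse `M` of the
Laplacian matrix. -/
theorem kirchhoffIndex_eq_of_lapMatrix_mul {V : Type*} [Fintype V] [DecidableEq V]
    {Γ : SimpleGraph V} [DecidableRel Γ.Adj] (hΓ : Γ.Connected) (M : Matrix V V ℝ) (c : V → ℝ)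
    (h : Γ.lapMatrix ℝ * M = 1 - vecMulVec c 1) :
    kirchhoffIndex Γ = Fintype.card V * M.trace - ∑ a, ∑ b, M a b := by
  -- The potential is column `a` minus column `b` of `M`; the rank-one term `c 1ᵀ` has equal columns
  -- and cancels.
  have hr (a b : V) : resistanceDistance Γ a b = (M a a - M a b) - (M b a - M b b) := by
    refine resistanceDistance_eq hΓ (p := fun v => M v a - M v b) ?_
    rw [isUnitCurrentPotential_iff_lapMatrix_mulVec]
    funext v
    have ha : (Γ.lapMatrix ℝ * M) v a = (1 - vecMulVec c 1 : Matrix V V ℝ) v a := by rw [h]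
    have hb : (Γ.lapMatrix ℝ * M) v b = (1 - vecMulVec c 1 : Matrix V V ℝ) v b := by rw [h]
    simp only [Matrix.mul_apply, Matrix.sub_apply, Matrix.one_apply, vecMulVec_apply,
      Pi.one_apply, mul_one] at ha hb
    simp only [Matrix.mulVec, dotProduct, mul_sub, Finset.sum_sub_distrib, ha, hb]
    ring
  simp only [kirchhoffIndex, hr, Finset.sum_sub_distrib, Finset.sum_const, Finset.card_univ,
    nsmul_eq_mul, Matrix.trace, Matrix.diag]
  rw [Finset.sum_comm (f := fun a b => M b a), ← Finset.mul_sum]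
  ring

/-! ### Incidence matrix and block form of the Laplacian -/

namespace SimpleGraph

variable {V : Type*} [DecidableEq V] (G : SimpleGraph V)

/-- The vertex-edge incidence matrix of a graph, its columns being indexed by the edges. -/
def edgeIncMatrix : Matrix V G.edgeSet ℝ :=
  Matrix.of fun v e => if v ∈ (e : Sym2 V) then 1 else 0

theorem edgeIncMatrix_apply (v : V) (e : G.edgeSet) :
    G.edgeIncMatrix v e = if v ∈ (e : Sym2 V) then 1 else 0 := rfl

theorem lapMatrix_apply [Fintype V] [DecidableRel G.Adj] (u v : V) :
    G.lapMatrix ℝ u v = (if u = v then (G.degree u : ℝ) else 0) - if G.Adj u v then 1 else 0 := by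
  simp only [lapMatrix, degMatrix, Matrix.sub_apply, Matrix.diagonal_apply, adjMatrix_apply]

section

variable [Fintype V]

theorem sum_edgeIncMatrix_left (e : G.edgeSet) : ∑ v, G.edgeIncMatrix v e = 2 := by
  obtain ⟨e, he⟩ := e
  induction e with | _ a b =>
  have hab : a ≠ b := G.ne_of_adj he
  simp only [edgeIncMatrix_apply, Sym2.mem_iff, Finset.sum_boole]
  rw [show (Finset.univ.filter fun v => v = a ∨ v = b) = {a, b} by ext; simp]
  rw [Finset.card_pair hab]
  norm_num

/-- Two distinct edges of a simple graph share at most one vertex, so off the diagonal the product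
has entries 0 or 1. -/
theorem edgeIncMatrix_transpose_mul_self [DecidableRel G.lineGraph.Adj] :
    G.edgeIncMatrix.transpose * G.edgeIncMatrix =
      (2 : ℝ) • (1 : Matrix G.edgeSet G.edgeSet ℝ) + G.lineGraph.adjMatrix ℝ := by
  ext e f
  have hef : (G.edgeIncMatrix.transpose * G.edgeIncMatrix) e f =
      ∑ v, if v ∈ (e : Sym2 V) ∧ v ∈ (f : Sym2 V) then (1 : ℝ) else 0 := by
    simp only [Matrix.mul_apply, Matrix.transpose_apply, edgeIncMatrix_apply, ite_and]
    exact Finset.sum_congr rfl fun v _ => by split_ifs <;> simp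
  simp only [hef, Matrix.add_apply, Matrix.smul_apply, Matrix.one_apply, adjMatrix_apply]
  rcases eq_or_ne e f with rfl | hne
  · simpa [edgeIncMatrix_apply] using G.sum_edgeIncMatrix_left e
  have hadj : G.lineGraph.Adj e f ↔ ∃ v, v ∈ (e : Sym2 V) ∧ v ∈ (f : Sym2 V) :=
    ⟨fun h => h.2, fun h => ⟨hne, h⟩⟩
  simp only [hne, if_false, smul_zero, zero_add]
  by_cases h : ∃ v, v ∈ (e : Sym2 V) ∧ v ∈ (f : Sym2 V)
  · rw [if_pos (hadj.2 h)]
    obtain ⟨v, hv⟩ := h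
    rw [Finset.sum_eq_single v, if_pos hv]
    · intro w _ hw
      rw [if_neg]
      exact fun hw' => hne (Subtype.ext
        (((Sym2.mem_and_mem_iff hw).1 ⟨hw'.1, hv.1⟩).trans
          ((Sym2.mem_and_mem_iff hw).1 ⟨hw'.2, hv.2⟩).symm))
    · simp
  · rw [if_neg fun h' => h (hadj.1 h')]
    exact Finset.sum_eq_zero fun v _ => if_neg fun hv => h ⟨v, hv⟩

end

variable [Fintype V] [Fintype G.edgeSet] [DecidableRel G.Adj]

/-- The columns of `incMatrix` are indexed by all of `Sym2 V`; those of non-edges vanish, so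
restricting to edges leaves the product unchanged. -/
theorem edgeIncMatrix_mul_transpose :
    G.edgeIncMatrix * G.edgeIncMatrix.transpose = G.degMatrix ℝ + G.adjMatrix ℝ := by
  ext u v
  have h := congrArg (fun M : Matrix V V ℝ => M u v) (G.incMatrix_mul_transpose (R := ℝ))
  have h1 : (G.edgeIncMatrix * G.edgeIncMatrix.transpose) u v =
      (G.incMatrix ℝ * (G.incMatrix ℝ).transpose) u v := by
    simp only [Matrix.mul_apply, Matrix.transpose_apply, edgeIncMatrix_apply, incMatrix_apply']
    rw [← Finset.sum_subset (Finset.subset_univ G.edgeSet.toFinset),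
      Finset.sum_subtype (p := fun e => e ∈ G.edgeSet) _ (fun e => Set.mem_toFinset)]
    · refine Finset.sum_congr rfl fun e _ => ?_
      simp only [incidenceSet, Set.mem_ofPred_eq, e.2, true_and]
    · intro e _ he
      rw [if_neg fun h => he (Set.mem_toFinset.2 h.1), zero_mul]
  rw [h1]
  refine h.trans ?_
  simp only [Matrix.of_apply, Matrix.add_apply, degMatrix, Matrix.diagonal_apply, adjMatrix_apply]
  by_cases huv : u = v
  · subst huv; simp
  · simp [huv]

theorem sum_edgeIncMatrix_right (v : V) : ∑ e, G.edgeIncMatrix v e = G.degree v := by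
  have h := congrArg (fun M : Matrix V V ℝ => M v v) G.edgeIncMatrix_mul_transpose
  simp only [Matrix.mul_apply, Matrix.transpose_apply, edgeIncMatrix_apply, Matrix.add_apply,
    degMatrix, Matrix.diagonal_apply, adjMatrix_apply, if_true, SimpleGraph.irrefl, if_false,
    add_zero] at h
  rw [← h]
  exact Finset.sum_congr rfl fun e _ => by rw [edgeIncMatrix_apply]; split_ifs <;> simp

-- Subdivision removes the edges of `G` between old vertices, so `G` enters the upper left block
-- only through its degrees.
open Matrix in
theorem lapMatrix_mergedSubdivision (H₁ : SimpleGraph V) (H₂ : SimpleGraph G.edgeSet)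
    [DecidableRel H₁.Adj] [DecidableRel H₂.Adj] [DecidableRel (mergedSubdivision G H₁ H₂).Adj] :
    (mergedSubdivision G H₁ H₂).lapMatrix ℝ =
      fromBlocks (G.degMatrix ℝ + H₁.lapMatrix ℝ) (-G.edgeIncMatrix) (-G.edgeIncMatrixᵀ)
        ((2 : ℝ) • 1 + H₂.lapMatrix ℝ) := by
  have a1 (u v : V) : (mergedSubdivision G H₁ H₂).Adj (.inl u) (.inl v) ↔ H₁.Adj u v := Iff.rfl
  have a2 (u : V) (e : G.edgeSet) :
    (mergedSubdivision G H₁ H₂).Adj (.inl u) (.inr e) ↔ u ∈ (e : Sym2 V) := Iff.rfl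
  have a3 (u : V) (e : G.edgeSet) :
    (mergedSubdivision G H₁ H₂).Adj (.inr e) (.inl u) ↔ u ∈ (e : Sym2 V) := Iff.rfl
  have a4 (e f : G.edgeSet) :
    (mergedSubdivision G H₁ H₂).Adj (.inr e) (.inr f) ↔ H₂.Adj e f := Iff.rfl
  have d1 (u : V) : ((mergedSubdivision G H₁ H₂).degree (.inl u) : ℝ) =
      G.degree u + H₁.degree u := by
    rw [degree_eq_sum_if_adj, Fintype.sum_sum_type, ← sum_edgeIncMatrix_right, add_comm,
      degree_eq_sum_if_adj]
    simp only [a1, a2, edgeIncMatrix_apply]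
  have d2 (e : G.edgeSet) : ((mergedSubdivision G H₁ H₂).degree (.inr e) : ℝ) =
      2 + H₂.degree e := by
    rw [degree_eq_sum_if_adj, Fintype.sum_sum_type, ← G.sum_edgeIncMatrix_left e,
      degree_eq_sum_if_adj]
    simp only [a3, a4, edgeIncMatrix_apply]
  ext (u | e) (v | f)
  · simp only [lapMatrix_apply, a1, d1, fromBlocks_apply₁₁, Matrix.add_apply, degMatrix,
      Matrix.diagonal_apply, Sum.inl.injEq]
    split_ifs <;> ring
  · simp [lapMatrix_apply, a2, edgeIncMatrix_apply]
  · simp [lapMatrix_apply, a3, edgeIncMatrix_apply]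
  · simp only [lapMatrix_apply, a4, d2, fromBlocks_apply₂₂, Matrix.add_apply, Matrix.smul_apply,
      Matrix.one_apply, Sum.inr.injEq, smul_eq_mul]
    split_ifs <;> ring

end SimpleGraph

/-! ### Block generalized inverses over a functional calculus -/

section BlockInverse

open Matrix

variable {V E ι : Type*} [Fintype V] [DecidableEq V] [Fintype E] [DecidableEq E]
  [Fintype ι] [DecidableEq ι]

theorem sum_sum_eq_trace_mul_one {W : Type*} [Fintype W] (N : Matrix W W ℝ) :
    ∑ a, ∑ b, N a b = (N * Matrix.of fun _ _ => 1).trace := by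
  simp [Matrix.trace, Matrix.mul_apply]

omit [Fintype ι] in
/-- The rows and columns of `φ f` sum to zero if `φ` is the functional calculus of a family for
which the constant vectors form the `i₀`-th eigenline and `f i₀ = 0`. -/
theorem sum_functionalCalculus_eq_zero (φ : (ι → ℝ) →ₐ[ℝ] Matrix V V ℝ) {n : ℝ} {i₀ : ι}
    (hJ : (Matrix.of fun _ _ => 1 : Matrix V V ℝ) = φ (Pi.single i₀ n)) {f : ι → ℝ}
    (hf : f i₀ = 0) (v : V) : ∑ w, φ f v w = 0 ∧ ∑ w, φ f w v = 0 := by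
  have hzero : f * Pi.single i₀ n = 0 := by
    ext i
    by_cases hi : i = i₀
    · subst hi; simp [hf]
    · simp [hi]
  have h₁ : φ f * (Matrix.of fun _ _ => 1 : Matrix V V ℝ) = 0 := by
    rw [hJ, ← map_mul, hzero, map_zero]
  have h₂ : (Matrix.of fun _ _ => 1 : Matrix V V ℝ) * φ f = 0 := by
    rw [hJ, ← map_mul, mul_comm, hzero, map_zero]
  constructor
  · simpa [Matrix.mul_apply] using congrArg (fun N : Matrix V V ℝ => N v v) h₁
  · simpa [Matrix.mul_apply] using congrArg (fun N : Matrix V V ℝ => N v v) h₂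

omit [Fintype ι] [DecidableEq ι] in
/-- A generalized inverse of a block matrix whose blocks are built from the functional calculus `φ`
of a commuting family and a rectangular matrix `B` with `B * Bᵀ = φ p`. -/
theorem fromBlocks_functionalCalculus_mul (φ : (ι → ℝ) →ₐ[ℝ] Matrix V V ℝ) (B : Matrix V E ℝ)
    {a p q s g h d : ι → ℝ} {α c : ℝ} (hα : α ≠ 0) (hB : B * Bᵀ = φ p)
    (hJ : (Matrix.of fun _ _ => c : Matrix V V ℝ) = φ d)
    (hJB : (Matrix.of fun _ _ => c : Matrix V E ℝ) = (1 / 2 : ℝ) • (φ d * B))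
    (h₁ : a * s - p * g = 1 - d) (h₂ : a * g - α⁻¹ • 1 - p * h = -((1 / 2 : ℝ) • d))
    (h₃ : (α • 1 + q * p) * g = s) (h₄ : (α • 1 + q * p) * h + α⁻¹ • q = g) :
    fromBlocks (φ a) (-B) (-Bᵀ) (α • 1 + Bᵀ * φ q * B) *
        fromBlocks (φ s) (φ g * B) (Bᵀ * φ g) (α⁻¹ • 1 + Bᵀ * φ h * B) =
      1 - vecMulVec (Sum.elim (fun _ => c) 0) 1 := by
  have hB' (N : Matrix V V ℝ) : B * (Bᵀ * N) = φ p * N := by rw [← Matrix.mul_assoc, hB]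
  have hB'' (N : Matrix V E ℝ) : B * (Bᵀ * N) = φ p * N := by rw [← Matrix.mul_assoc, hB]
  have hJ' : vecMulVec (Sum.elim (fun _ : V => c) (0 : E → ℝ)) 1 =
      fromBlocks (φ d) ((1 / 2 : ℝ) • (φ d * B)) 0 0 := by
    rw [← hJB, ← hJ]
    ext (i | i) (j | j) <;> simp [vecMulVec_apply]
  rw [hJ', fromBlocks_multiply, ← fromBlocks_one, sub_eq_add_neg, fromBlocks_neg, fromBlocks_add]
  congr 1
  · rw [← sub_eq_add_neg, ← map_one φ, ← map_sub, ← h₁, Matrix.neg_mul, hB', map_sub, map_mul,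
      map_mul, sub_eq_add_neg]
  · rw [zero_add, ← Matrix.smul_mul, ← Matrix.neg_mul, ← map_smul, ← map_neg, ← h₂]
    simp only [map_sub, map_mul, map_smul, map_one, Matrix.sub_mul, Matrix.mul_add, Matrix.neg_mul,
      Matrix.mul_smul, Matrix.mul_one, Matrix.one_mul, Matrix.smul_mul, Matrix.mul_assoc, hB'',
      smul_neg]
    abel
  · rw [neg_zero, add_zero, ← h₃]
    simp only [map_add, map_mul, map_smul, map_one, Matrix.add_mul, Matrix.mul_add, Matrix.neg_mul,
      Matrix.mul_smul, Matrix.one_mul, Matrix.smul_mul, Matrix.mul_assoc, hB', smul_neg]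
    abel
  · rw [neg_zero, add_zero, ← h₄]
    simp only [map_add, map_mul, map_smul, map_one, Matrix.add_mul, Matrix.mul_add, Matrix.neg_mul,
      Matrix.mul_smul, Matrix.mul_one, Matrix.one_mul, Matrix.smul_mul, Matrix.mul_assoc, hB'',
      smul_neg, smul_add, smul_smul, inv_mul_cancel₀ hα, one_smul]
    abel

-- Cyclicity of the trace turns `Bᵀ * φ h * B` into `φ h * φ p`.
omit [DecidableEq ι] in
theorem trace_fromBlocks_functionalCalculus (φ : (ι → ℝ) →ₐ[ℝ] Matrix V V ℝ) (B : Matrix V E ℝ)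
    (htr : ∀ f, (φ f).trace = ∑ i, f i) {p s g h : ι → ℝ} {β : ℝ} (hB : B * Bᵀ = φ p) :
    (fromBlocks (φ s) (φ g * B) (Bᵀ * φ g) (β • 1 + Bᵀ * φ h * B)).trace =
      ∑ i, s i + (β * Fintype.card E + ∑ i, p i * h i) := by
  have ht : (fromBlocks (φ s) (φ g * B) (Bᵀ * φ g) (β • 1 + Bᵀ * φ h * B)).trace =
      (φ s).trace + (β • (1 : Matrix E E ℝ) + Bᵀ * φ h * B).trace := by
    simp [Matrix.trace, Fintype.sum_sum_type]
  rw [ht, htr, trace_add, trace_smul, trace_one, Matrix.mul_assoc,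
    Matrix.trace_mul_comm, Matrix.mul_assoc, hB, ← map_mul, htr, smul_eq_mul]
  simp [mul_comm]

/-- Blocks built from `s` and `g` sum to zero because both vanish at `i₀`. Summing entries is
pairing with the all-ones matrix, so of `h` only the value at `i₀` survives. -/
theorem sum_fromBlocks_functionalCalculus (φ : (ι → ℝ) →ₐ[ℝ] Matrix V V ℝ) (B : Matrix V E ℝ)
    (htr : ∀ f, (φ f).trace = ∑ i, f i) {p s g h : ι → ℝ} {n β : ℝ} {i₀ : ι}
    (hB : B * Bᵀ = φ p) (hsum : ∀ e, ∑ v, B v e = 2)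
    (hJ : (Matrix.of fun _ _ => 1 : Matrix V V ℝ) = φ (Pi.single i₀ n))
    (hs : s i₀ = 0) (hg : g i₀ = 0) :
    ∑ i, ∑ j, fromBlocks (φ s) (φ g * B) (Bᵀ * φ g) (β • 1 + Bᵀ * φ h * B) i j =
      β * Fintype.card E + n * h i₀ * p i₀ ^ 2 / 4 := by
  have hrow {f : ι → ℝ} (hf : f i₀ = 0) (v : V) := (sum_functionalCalculus_eq_zero φ hJ hf v).1
  have hcol {f : ι → ℝ} (hf : f i₀ = 0) (v : V) := (sum_functionalCalculus_eq_zero φ hJ hf v).2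
  have hJE : (Matrix.of fun _ _ => 1 : Matrix E E ℝ) =
      (1 / 4 : ℝ) • (Bᵀ * φ (Pi.single i₀ n) * B) := by
    rw [← hJ]
    ext e f
    simp [Matrix.mul_apply, hsum, ← Finset.mul_sum]
    norm_num
  simp only [Fintype.sum_sum_type, fromBlocks_apply₁₁, fromBlocks_apply₁₂, fromBlocks_apply₂₁,
    fromBlocks_apply₂₂, Finset.sum_add_distrib]
  have e₁ : ∑ v, ∑ w, φ s v w = 0 := Finset.sum_eq_zero fun v _ => hrow hs v
  have e₂ : ∑ v, ∑ e, (φ g * B) v e = 0 := by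
    refine Finset.sum_comm.trans (Finset.sum_eq_zero fun e _ => ?_)
    simp only [Matrix.mul_apply]
    rw [Finset.sum_comm]
    simp [← Finset.sum_mul, hcol hg]
  have e₃ : ∑ e, ∑ v, (Bᵀ * φ g) e v = 0 := by
    refine Finset.sum_eq_zero fun e _ => ?_
    simp only [Matrix.mul_apply]
    rw [Finset.sum_comm]
    simp [← Finset.mul_sum, hrow hg]
  have e₄ : ∑ e, ∑ f, (β • 1 + Bᵀ * φ h * B : Matrix E E ℝ) e f =
      β * Fintype.card E + n * h i₀ * p i₀ ^ 2 / 4 := by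
    simp only [Matrix.add_apply, Finset.sum_add_distrib]
    congr 1
    · simp [Matrix.one_apply, mul_comm]
    · rw [sum_sum_eq_trace_mul_one, hJE, Matrix.mul_smul, trace_smul]
      have : Bᵀ * φ h * B * (Bᵀ * φ (Pi.single i₀ n) * B) =
          Bᵀ * (φ h * (B * Bᵀ) * φ (Pi.single i₀ n) * B) := by
        simp only [Matrix.mul_assoc]
      rw [this, Matrix.trace_mul_comm, Matrix.mul_assoc, hB, ← map_mul, ← map_mul, ← map_mul, htr,
        Finset.sum_eq_single i₀]
      · simp; ring
      · intro i _ hi; simp [hi]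
      · simp
  linear_combination e₁ + e₂ + e₃ + e₄

end BlockInverse

/-! ### Laplacians of complements, line graphs and regular graphs -/

namespace SimpleGraph

open Matrix

theorem lapMatrix_bot {V : Type*} [Fintype V] [DecidableEq V]
    [DecidableRel (⊥ : SimpleGraph V).Adj] : (⊥ : SimpleGraph V).lapMatrix ℝ = 0 := by
  ext u v
  simp [lapMatrix_apply]

theorem lapMatrix_top {V : Type*} [Fintype V] [DecidableEq V]
    [DecidableRel (⊤ : SimpleGraph V).Adj] :
    (⊤ : SimpleGraph V).lapMatrix ℝ =
      (Fintype.card V : ℝ) • 1 - Matrix.of fun _ _ => 1 := by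
  have hadj (u v : V) : (if (⊤ : SimpleGraph V).Adj u v then (1 : ℝ) else 0) =
      1 - if u = v then 1 else 0 := by
    by_cases h : u = v <;> simp [h]
  ext u v
  simp only [lapMatrix_apply, degree_eq_sum_if_adj, hadj, Matrix.sub_apply, Matrix.smul_apply,
    Matrix.one_apply, Matrix.of_apply, smul_eq_mul, Finset.sum_sub_distrib]
  by_cases h : u = v
  · subst h; simp
  · simp [h]

theorem lapMatrix_compl {V : Type*} [Fintype V] [DecidableEq V] (G : SimpleGraph V)
    [DecidableRel G.Adj] [DecidableRel Gᶜ.Adj] :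
    Gᶜ.lapMatrix ℝ =
      (Fintype.card V : ℝ) • 1 - (Matrix.of fun _ _ => 1) - G.lapMatrix ℝ := by
  have hadj (u v : V) : (if Gᶜ.Adj u v then (1 : ℝ) else 0) =
      1 - (if u = v then 1 else 0) - if G.Adj u v then 1 else 0 := by
    by_cases h : u = v
    · subst h; simp
    · by_cases h' : G.Adj u v <;> simp [h, h']
  ext u v
  simp only [lapMatrix_apply, degree_eq_sum_if_adj, hadj, Matrix.sub_apply, Matrix.smul_apply,
    Matrix.one_apply, Matrix.of_apply, smul_eq_mul, Finset.sum_sub_distrib]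
  by_cases h : u = v
  · subst h; simp
  · simp only [h, if_false]; ring

variable {V : Type*} [Fintype V] [DecidableEq V] (G : SimpleGraph V) [DecidableRel G.Adj]
  {r : ℕ}

theorem IsRegularOfDegree.edgeIncMatrix_mul_transpose {G : SimpleGraph V} [DecidableRel G.Adj]
    [Fintype G.edgeSet] (hr : G.IsRegularOfDegree r) :
    G.edgeIncMatrix * G.edgeIncMatrixᵀ = (2 * r : ℝ) • 1 - G.lapMatrix ℝ := by
  have hdeg : G.degMatrix ℝ = (r : ℝ) • 1 := by
    ext u v
    simp [degMatrix, Matrix.diagonal_apply, Matrix.one_apply, hr u]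
  rw [SimpleGraph.edgeIncMatrix_mul_transpose, lapMatrix, hdeg, two_mul, add_smul]
  abel

theorem IsRegularOfDegree.lapMatrix_lineGraph {G : SimpleGraph V} [DecidableRel G.Adj]
    [Fintype G.edgeSet] [DecidableRel G.lineGraph.Adj] (hr : G.IsRegularOfDegree r) :
    G.lineGraph.lapMatrix ℝ = (2 * r : ℝ) • 1 - G.edgeIncMatrixᵀ * G.edgeIncMatrix := by
  have hdeg (e : G.edgeSet) : (G.lineGraph.degree e : ℝ) = 2 * r - 2 := by
    have h : ∑ f, (G.edgeIncMatrixᵀ * G.edgeIncMatrix) e f = 2 * r := by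
      simp only [Matrix.mul_apply]
      rw [Finset.sum_comm]
      simp only [← Finset.mul_sum, sum_edgeIncMatrix_right, hr.degree_eq, ← Finset.sum_mul,
        Matrix.transpose_apply, sum_edgeIncMatrix_left]
    rw [edgeIncMatrix_transpose_mul_self] at h
    simp only [Matrix.add_apply, Finset.sum_add_distrib, Matrix.smul_apply, Matrix.one_apply,
      adjMatrix_apply, ← degree_eq_sum_if_adj] at h
    simp at h
    linarith
  rw [edgeIncMatrix_transpose_mul_self]
  ext e f
  simp only [lapMatrix_apply, hdeg, Matrix.sub_apply, Matrix.add_apply, Matrix.smul_apply,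
    Matrix.one_apply, adjMatrix_apply, smul_eq_mul]
  split_ifs <;> ring

omit [DecidableEq V] in
theorem IsRegularOfDegree.card_mul_degree {G : SimpleGraph V} [DecidableRel G.Adj]
    (hr : G.IsRegularOfDegree r) : Fintype.card V * r = 2 * G.edgeFinset.card := by
  rw [← G.sum_degrees_eq_twice_card_edges]
  simp [hr.degree_eq]

end SimpleGraph

/-! ### The regular case -/

open Matrix in
/-- The Kirchhoff index of a merged subdivision graph of a regular graph `G`, in terms of the
functional calculus `φ` of the commuting Laplacian matrices of `G` and `H`. -/
theorem kirchhoffIndex_mergedSubdivision_of_functionalCalculus {V : Type*} [Fintype V]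
    [DecidableEq V] {G H : SimpleGraph V} [DecidableRel G.Adj] [DecidableRel H.Adj]
    {H₂ : SimpleGraph G.edgeSet} [DecidableRel H₂.Adj]
    {n m r : ℕ} [NeZero n]
    (hn : Fintype.card V = n) (hm : Fintype.card G.edgeSet = m) (hr : G.IsRegularOfDegree r)
    (hconn : (mergedSubdivision G H H₂).Connected)
    (φ : (Fin n → ℝ) →ₐ[ℝ] Matrix V V ℝ) (htr : ∀ f, (φ f).trace = ∑ i, f i)
    (hsymm : ∀ f, (φ f)ᵀ = φ f) {μG μH : Fin n → ℝ}
    (hJ : (Matrix.of fun _ _ => 1 : Matrix V V ℝ) = φ (Pi.single 0 (n : ℝ)))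
    (hG : G.lapMatrix ℝ = φ μG) (hH : H.lapMatrix ℝ = φ μH) (hG0 : μG 0 = 0)
    {α β γ : ℝ} (hα : 0 < α) (hγ : 0 ≤ γ) (h0 : α - β * m + 2 * r * γ = 2)
    (hC : (2 : ℝ) • 1 + H₂.lapMatrix ℝ = α • 1 - β • (Matrix.of fun _ _ => 1) +
      γ • (G.edgeIncMatrixᵀ * G.edgeIncMatrix)) :
    kirchhoffIndex (mergedSubdivision G H H₂) =
      (n : ℝ) / 2 + ((m : ℝ) ^ 2 - (n : ℝ) ^ 2) / α +
        ((m : ℝ) + n) * ∑ i ∈ Finset.univ.erase (0 : Fin n),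
          (α + γ * (2 * r - μG i) + (r + μH i)) /
            ((r + μH i) * (α + γ * (2 * r - μG i)) - (2 * r - μG i)) := by
  classical
  have hn0 : (n : ℝ) ≠ 0 := Nat.cast_ne_zero.2 (NeZero.ne n)
  have hα0 : α ≠ 0 := hα.ne'
  have hnr : (n : ℝ) * r = 2 * m := by
    have := hr.card_mul_degree
    rw [hn, SimpleGraph.edgeFinset_card, hm] at this
    exact_mod_cast this
  set B := G.edgeIncMatrix with hBdef
  set a : Fin n → ℝ := fun i => r + μH i with ha
  set p : Fin n → ℝ := fun i => 2 * r - μG i with hp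
  -- The all-ones matrix on edges is `Bᵀ * φ (n e₀) * B / 4`, so the `β` term is absorbed into `Bᵀ *
  -- φ q * B` as a correction at index 0.
  set q : Fin n → ℝ := fun i => γ - Pi.single (M := fun _ => ℝ) 0 (β * n / 4) i with hq
  have hconst (c : ℝ) : φ (fun _ => c) = c • 1 := by
    rw [← map_one φ, ← map_smul]; congr 1; ext; simp
  have hR : G.degMatrix ℝ + H.lapMatrix ℝ = φ a := by
    have : a = (fun _ => (r : ℝ)) + μH := rfl
    rw [this, map_add, hconst, hH]
    congr 1
    ext u v
    simp [SimpleGraph.degMatrix, Matrix.diagonal_apply, Matrix.one_apply, hr u]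
  have hB : B * Bᵀ = φ p := by
    have : p = (fun _ => (2 * r : ℝ)) - μG := rfl
    rw [this, map_sub, hconst, ← hG, hr.edgeIncMatrix_mul_transpose]
  have hsum : ∀ e, ∑ v, B v e = 2 := G.sum_edgeIncMatrix_left
  have hJE : (Matrix.of fun _ _ => 1 : Matrix G.edgeSet G.edgeSet ℝ) =
      Bᵀ * ((1 / 4 : ℝ) • φ (Pi.single 0 (n : ℝ))) * B := by
    rw [← hJ]
    ext e f
    simp [Matrix.mul_apply, hsum, ← Finset.mul_sum, ← Finset.sum_mul]
    norm_num
  have hC' : (2 : ℝ) • 1 + H₂.lapMatrix ℝ = α • 1 + Bᵀ * φ q * B := by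
    have : q = (fun _ => γ) - β • (1 / 4 : ℝ) • Pi.single (M := fun _ => ℝ) 0 (n : ℝ) := by
      ext i
      by_cases hi : i = 0
      · subst hi; simp [hq]; ring
      · simp [hq, hi]
    rw [hC, this, map_sub, hconst, map_smul, map_smul, hJE]
    simp only [Matrix.mul_sub, Matrix.sub_mul, Matrix.mul_smul, Matrix.smul_mul, Matrix.mul_one]
    abel
  have hL : (mergedSubdivision G H H₂).lapMatrix ℝ =
      fromBlocks (φ a) (-B) (-Bᵀ) (α • 1 + Bᵀ * φ q * B) := by
    rw [SimpleGraph.lapMatrix_mergedSubdivision, hR, hC']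
  -- `p i` is the squared Frobenius norm of `φ (e i) * B`.
  have hp_nonneg (i : Fin n) : 0 ≤ p i := by
    have h1 : ((φ (Pi.single i 1) * B) * (φ (Pi.single i 1) * B)ᵀ).trace = p i := by
      rw [Matrix.transpose_mul, hsymm, ← Matrix.mul_assoc, Matrix.mul_assoc _ B, hB, ← map_mul,
        ← map_mul, htr, Finset.sum_eq_single i]
      · simp
      · intro j _ hj; simp [hj]
      · simp
    rw [← h1]
    exact Finset.sum_nonneg fun v _ => Finset.sum_nonneg fun e _ => mul_self_nonneg _
  set κ : Fin n → ℝ := fun i => α + γ * p i with hκdef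
  have hκ (i : Fin n) : 0 < κ i := by have := mul_nonneg hγ (hp_nonneg i); simp only [κ]; linarith
  have hq0 {i : Fin n} (hi : i ≠ 0) : q i = γ := by simp [q, hi]
  set Δ : Fin n → ℝ := fun i => a i * κ i - p i with hΔdef
  -- If `Δ i = 0`, the `i`-th eigenprojection `φ (e i)` lifts to a matrix whose columns lie in the
  -- kernel of the Laplacian. By connectedness they are constant, so the columns of `φ (e i)` are
  -- constant; these sum to zero since `i ≠ 0`, hence vanish, against trace 1.
  have hΔ {i : Fin n} (hi : i ≠ 0) : Δ i ≠ 0 := by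
    intro hΔi
    have hker : (mergedSubdivision G H H₂).lapMatrix ℝ *
        fromRows (κ i • φ (Pi.single i 1)) (Bᵀ * φ (Pi.single i 1)) = 0 := by
      have e₁ : a * κ i • Pi.single i 1 = p * Pi.single i 1 := by
        ext j
        by_cases hj : j = i
        · subst hj; simp only [hΔdef] at hΔi; simp; linarith
        · simp [hj]
      have e₂ : α • Pi.single i 1 + q * (p * Pi.single i 1) = κ i • Pi.single i (1 : ℝ) := by
        ext j
        by_cases hj : j = i
        · subst hj; simp [hq0 hi, hκdef]
        · simp [hj]
      rw [hL, fromBlocks_mul_fromRows, ← map_smul, ← fromRows_zero]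
      congr 1
      · rw [← map_mul, Matrix.neg_mul, ← Matrix.mul_assoc, hB, ← map_mul, e₁, add_neg_cancel]
      · rw [← e₂, Matrix.add_mul, Matrix.mul_assoc (Bᵀ * φ q), ← Matrix.mul_assoc B, hB,
          Matrix.mul_assoc Bᵀ, ← map_mul, ← map_mul, map_add, map_smul, Matrix.neg_mul,
          Matrix.smul_mul, Matrix.one_mul, Matrix.mul_add, Matrix.mul_smul, ← sub_eq_neg_add,
          ← sub_eq_zero]
        abel
    have hcol (v w u : V) : φ (Pi.single i 1) v u = φ (Pi.single i 1) w u := by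
      have h1 : (mergedSubdivision G H H₂).lapMatrix ℝ *ᵥ (fun z =>
          fromRows (κ i • φ (Pi.single i 1)) (Bᵀ * φ (Pi.single i 1)) z u) = 0 := by
        ext z
        exact congrArg (fun N : Matrix _ V ℝ => N z u) hker
      have h2 := ((mergedSubdivision G H H₂).lapMatrix_mulVec_eq_zero_iff_forall_reachable).1 h1
        (.inl v) (.inl w) (hconn.preconnected _ _)
      simp only [fromRows_apply_inl, Matrix.smul_apply, smul_eq_mul] at h2
      exact mul_left_cancel₀ (hκ i).ne' h2
    have hzero : φ (Pi.single i 1) = 0 := by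
      ext v u
      have h1 := (sum_functionalCalculus_eq_zero φ hJ (f := Pi.single i 1) (by simp [hi.symm]) u).2
      rw [Finset.sum_congr rfl fun w _ => hcol w v u] at h1
      simp only [Finset.sum_const, Finset.card_univ, hn, nsmul_eq_mul] at h1
      simpa [hn0] using h1
    have := htr (Pi.single i 1)
    rw [hzero] at this
    simp at this
  set g : Fin n → ℝ := fun i => if i = 0 then 0 else (Δ i)⁻¹ with hg
  set s : Fin n → ℝ := fun i => if i = 0 then 0 else κ i * (Δ i)⁻¹ with hs
  -- Solved from the last scalar equation, which divides by `κ i > 0`; the second one would divide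
  -- by `p i`, which may be 0. At index 0 the factor `α + q 0 * p 0` replacing `κ` equals 2.
  set h : Fin n → ℝ := fun i => if i = 0 then -q 0 / (2 * α) else ((Δ i)⁻¹ - α⁻¹ * γ) / κ i with hh
  have hd (i : Fin n) : Pi.single (M := fun _ => ℝ) 0 (1 : ℝ) i = if i = 0 then 1 else 0 := by
    simp [Pi.single_apply]
  -- On constant vectors `2 + L(H₂)` acts as 2; this is `h0` rewritten with `n r = 2 m`.
  have hpq : α + q 0 * p 0 = 2 := by
    simp only [q, p, Pi.single_eq_same, hG0]
    linear_combination h0 - β / 2 * hnr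
  have hJ' : (Matrix.of fun _ _ => (1 / n : ℝ) : Matrix V V ℝ) = φ (Pi.single 0 1) := by
    have : (Pi.single 0 1 : Fin n → ℝ) = (1 / n : ℝ) • Pi.single (M := fun _ => ℝ) 0 (n : ℝ) := by
      ext i
      by_cases hi : i = 0
      · subst hi; simp [hn0]
      · simp [hi]
    rw [this, map_smul, ← hJ]
    ext; simp
  have hph {i : Fin n} (hi : i ≠ 0) : p i * h i = a i * (Δ i)⁻¹ - α⁻¹ := by
    have h1 := hΔ hi
    have h2 := (hκ i).ne'
    simp only [hh, if_neg hi]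
    field_simp
    simp only [hΔdef, hκdef]
    ring
  have hinv : (mergedSubdivision G H H₂).lapMatrix ℝ *
      fromBlocks (φ s) (φ g * B) (Bᵀ * φ g) (α⁻¹ • 1 + Bᵀ * φ h * B) =
        1 - vecMulVec (Sum.elim (fun _ => (1 / n : ℝ)) 0) 1 := by
    rw [hL]
    refine fromBlocks_functionalCalculus_mul φ B hα0 hB hJ' ?_ ?_ ?_ ?_ ?_
    · rw [← hJ']
      ext v e
      simp [Matrix.mul_apply, ← Finset.mul_sum, hsum]
      ring
    · ext i
      simp only [Pi.sub_apply, Pi.mul_apply, Pi.one_apply, hd, hs, hg]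
      split_ifs with hi
      · simp
      · have := hΔ hi
        field_simp
        simp only [hΔdef]
        ring
    · ext i
      by_cases hi : i = 0
      · subst hi
        simp only [Pi.sub_apply, Pi.mul_apply, Pi.one_apply, Pi.neg_apply, Pi.smul_apply, hd, hg,
          hh, if_true, smul_eq_mul]
        field_simp
        linear_combination hpq
      · have := hph hi
        simp only [Pi.sub_apply, Pi.mul_apply, Pi.one_apply, Pi.neg_apply, Pi.smul_apply, hd, hg,
          if_neg hi, smul_eq_mul, this]
        ring
    · ext i
      by_cases hi : i = 0
      · simp [hs, hg, hi]
      · simp [hs, hg, hi, hq0 hi, hκdef]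
    · ext i
      by_cases hi : i = 0
      · subst hi
        simp only [Pi.add_apply, Pi.mul_apply, Pi.one_apply, Pi.smul_apply, hg,
          hh, if_true, smul_eq_mul]
        field_simp
        linear_combination -q 0 * hpq
      · have h2 : α + γ * p i ≠ 0 := (hκ i).ne'
        simp only [Pi.add_apply, Pi.mul_apply, Pi.one_apply, Pi.smul_apply, hg, hh,
          if_neg hi, smul_eq_mul, hq0 hi, hκdef, mul_one]
        rw [mul_div_cancel₀ _ h2]
        ring
  rw [kirchhoffIndex_eq_of_lapMatrix_mul hconn _ _ hinv,
    trace_fromBlocks_functionalCalculus φ B htr hB,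
    sum_fromBlocks_functionalCalculus φ B htr hB hsum hJ (by simp [hs]) (by simp [hg]),
    Fintype.card_sum, Nat.cast_add, hm, hn]
  -- Together with `hP` this makes the trace `1/2 + (m - n)/α + ∑ (κ i + a i)/Δ i`, while the entry
  -- sum is `m/2`.
  have hsumi : ∑ i, s i + ∑ i, p i * h i =
      p 0 * h 0 - (n - 1) * α⁻¹ + ∑ i ∈ Finset.univ.erase (0 : Fin n), (κ i + a i) / Δ i := by
    rw [← Finset.sum_add_distrib, ← Finset.add_sum_erase _ _ (Finset.mem_univ (0 : Fin n))]
    have : ∀ i ∈ Finset.univ.erase (0 : Fin n), s i + p i * h i = (κ i + a i) / Δ i - α⁻¹ := by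
      intro i hi
      have hi' := Finset.ne_of_mem_erase hi
      rw [hph hi']
      simp only [hs, if_neg hi']
      ring
    rw [Finset.sum_congr rfl this, Finset.sum_sub_distrib]
    simp only [Finset.sum_const, Finset.card_erase_of_mem (Finset.mem_univ _), Finset.card_univ,
      Fintype.card_fin, nsmul_eq_mul, Nat.cast_pred (NeZero.pos n), hs, if_true]
    ring
  have hp0 : p 0 = 2 * r := by simp [hp, hG0]
  have hh0 : h 0 = -q 0 / (2 * α) := by simp [hh]
  have hP : p 0 * h 0 = 1 / 2 - α⁻¹ := by
    rw [hh0]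
    field_simp
    linear_combination -hpq
  change _ = (n : ℝ) / 2 + ((m : ℝ) ^ 2 - (n : ℝ) ^ 2) / α + ((m : ℝ) + n) *
    ∑ i ∈ Finset.univ.erase (0 : Fin n), (κ i + a i) / Δ i
  rw [div_eq_mul_inv _ α]
  linear_combination ((n : ℝ) + m) * hsumi + n * hP - p 0 * h 0 / 2 * hnr -
    n * h 0 * p 0 / 4 * hp0

/-! ### Functional calculus of a joint eigenbasis -/

open Matrix in
/-- The functional calculus `f ↦ X * diagonal f * Xᵀ` of an orthogonal matrix `X`. -/
noncomputable def orthogonalCalculus {V ι : Type*} [Fintype V] [DecidableEq V] [Fintype ι]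
    [DecidableEq ι] (X : Matrix V ι ℝ) (h : Xᵀ * X = 1) (h' : X * Xᵀ = 1) :
    (ι → ℝ) →ₐ[ℝ] Matrix V V ℝ where
  toFun f := X * diagonal f * Xᵀ
  map_one' := by
    rw [show diagonal (1 : ι → ℝ) = 1 from diagonal_one, Matrix.mul_one, h']
  map_mul' f g := by
    have : X * diagonal f * Xᵀ * (X * diagonal g * Xᵀ) =
        X * (diagonal f * (Xᵀ * X) * diagonal g) * Xᵀ := by simp only [Matrix.mul_assoc]
    rw [this, h, Matrix.mul_one, diagonal_mul_diagonal]
    rfl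
  map_zero' := by
    rw [show diagonal (0 : ι → ℝ) = 0 from diagonal_zero, Matrix.mul_zero, Matrix.zero_mul]
  map_add' f g := by
    rw [← Matrix.add_mul, ← Matrix.mul_add, diagonal_add]
    rfl
  commutes' c := by
    have : diagonal (algebraMap ℝ (ι → ℝ) c) = c • (1 : Matrix ι ι ℝ) := by
      ext i j; simp [diagonal_apply, Matrix.one_apply]
    rw [this, Matrix.mul_smul, Matrix.smul_mul, Matrix.mul_one, h', Algebra.algebraMap_eq_smul_one]

section

open Matrix

variable {V ι : Type*} [Fintype V] [DecidableEq V] [Fintype ι] [DecidableEq ι] (X : Matrix V ι ℝ)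
  (h : Xᵀ * X = 1) (h' : X * Xᵀ = 1)

theorem orthogonalCalculus_apply (f : ι → ℝ) :
    orthogonalCalculus X h h' f = X * diagonal f * Xᵀ := rfl

theorem trace_orthogonalCalculus (f : ι → ℝ) :
    (orthogonalCalculus X h h' f).trace = ∑ i, f i := by
  rw [orthogonalCalculus_apply, Matrix.trace_mul_comm, ← Matrix.mul_assoc, h, Matrix.one_mul,
    trace_diagonal]

theorem transpose_orthogonalCalculus (f : ι → ℝ) :
    (orthogonalCalculus X h h' f)ᵀ = orthogonalCalculus X h h' f := by
  simp [orthogonalCalculus_apply, Matrix.transpose_mul, Matrix.mul_assoc]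

theorem eq_orthogonalCalculus {N : Matrix V V ℝ} {μ : ι → ℝ}
    (hN : ∀ i, N *ᵥ (fun v => X v i) = μ i • fun v => X v i) :
    N = orthogonalCalculus X h h' μ := by
  have : N * X = X * diagonal μ := by
    ext v i
    rw [Matrix.mul_diagonal, mul_comm]
    exact congrFun (hN i) v
  rw [orthogonalCalculus_apply, ← this, Matrix.mul_assoc, h', Matrix.mul_one]

/-- The matrix whose columns are the members of an orthonormal basis. -/
noncomputable def OrthonormalBasis.columnMatrix (x : OrthonormalBasis ι ℝ (EuclideanSpace ℝ V)) :
    Matrix V ι ℝ := Matrix.of fun v i => x i v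

omit [DecidableEq V] in
theorem OrthonormalBasis.columnMatrix_transpose_mul
    (x : OrthonormalBasis ι ℝ (EuclideanSpace ℝ V)) : x.columnMatrixᵀ * x.columnMatrix = 1 := by
  ext i j
  have := orthonormal_iff_ite.1 x.orthonormal i j
  rw [PiLp.inner_apply] at this
  simp only [Matrix.mul_apply, columnMatrix, Matrix.transpose_apply, Matrix.of_apply,
    Matrix.one_apply, ← this]
  exact Finset.sum_congr rfl fun v _ => by simp [mul_comm]

theorem OrthonormalBasis.columnMatrix_mul_transpose
    (x : OrthonormalBasis ι ℝ (EuclideanSpace ℝ V)) : x.columnMatrix * x.columnMatrixᵀ = 1 := by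
  refine (Matrix.mul_eq_one_comm_of_card_eq _ _ _ ?_).1 x.columnMatrix_transpose_mul
  have := Module.finrank_eq_card_basis x.toBasis
  rw [finrank_euclideanSpace] at this
  simpa using this.symm

-- The reflection changes `y` by a multiple of `w`, which `N` kills. By symmetry `μ * ⟪w, y⟫ = 0`,
-- so either `μ = 0` or `y` is fixed.
omit [DecidableEq V] in
theorem mulVec_reflection_eq {N : Matrix V V ℝ} (hN : N.IsSymm) {w : EuclideanSpace ℝ V}
    (hw : N *ᵥ w.ofLp = 0) (y : EuclideanSpace ℝ V) {μ : ℝ} (hy : N *ᵥ y.ofLp = μ • y.ofLp) :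
    N *ᵥ ((ℝ ∙ w)ᗮ.reflection y).ofLp = μ • ((ℝ ∙ w)ᗮ.reflection y).ofLp := by
  have hin : μ * inner ℝ w y = 0 := by
    have h1 : w.ofLp ⬝ᵥ (N *ᵥ y.ofLp) = 0 := by
      rw [Matrix.dotProduct_mulVec, ← Matrix.mulVec_transpose, hN, hw, zero_dotProduct]
    rw [hy, dotProduct_smul, smul_eq_mul] at h1
    rw [← h1, PiLp.inner_apply]
    simp [dotProduct, mul_comm]
  obtain ⟨c, hc, hcμ⟩ : ∃ c : ℝ, (ℝ ∙ w)ᗮ.reflection y = y - c • w ∧ μ * c = 0 := by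
    refine ⟨2 * (inner ℝ w y / ((‖w‖ : ℝ) ^ 2)), ?_, ?_⟩
    · rw [Submodule.reflection_orthogonal_apply, Submodule.reflection_singleton_apply]
      simp [two_smul, two_mul, add_smul]
    · linear_combination (2 / ‖w‖ ^ 2) * hin
  rw [hc]
  simp only [WithLp.ofLp_sub, WithLp.ofLp_smul, Matrix.mulVec_sub, Matrix.mulVec_smul, hw, hy,
    smul_zero, smul_sub, smul_smul, hcμ, zero_smul]

/-- A joint eigenbasis of two Laplacian matrices can be chosen to start with a constant vector. -/
theorem IsJointLaplacianSpectrum.exists_basis {G H : SimpleGraph V}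
    [DecidableRel G.Adj] [DecidableRel H.Adj] {n : ℕ} [NeZero n] {μG μH : Fin n → ℝ}
    (hspec : IsJointLaplacianSpectrum G H μG μH) :
    ∃ x : OrthonormalBasis (Fin n) ℝ (EuclideanSpace ℝ V), (∃ c : ℝ, ∀ v, x 0 v = c) ∧
      ∀ i, (G.lapMatrix ℝ) *ᵥ (x i).ofLp = μG i • (x i).ofLp ∧
        (H.lapMatrix ℝ) *ᵥ (x i).ofLp = μH i • (x i).ofLp := by
  obtain ⟨hG0, hH0, x, hx⟩ := hspec
  have hcard : Fintype.card V = n := by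
    have := Module.finrank_eq_card_basis x.toBasis
    rwa [finrank_euclideanSpace, Fintype.card_fin] at this
  set u : EuclideanSpace ℝ V := WithLp.toLp 2 fun _ => (√n)⁻¹ with hu
  have hnorm : ‖x 0‖ = ‖u‖ := by
    rw [x.orthonormal.1 0, EuclideanSpace.norm_eq]
    have hn : (n : ℝ) ≠ 0 := Nat.cast_ne_zero.2 (NeZero.ne n)
    simp [hu, hcard, hn]
  have hker (Γ : SimpleGraph V) [DecidableRel Γ.Adj] (h : Γ.lapMatrix ℝ *ᵥ (x 0).ofLp = 0) :
      Γ.lapMatrix ℝ *ᵥ (x 0 - u).ofLp = 0 := by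
    rw [WithLp.ofLp_sub, Matrix.mulVec_sub, h, zero_sub, neg_eq_zero]
    have : u.ofLp = (√n)⁻¹ • fun _ => (1 : ℝ) := by ext; simp [hu]
    rw [this, Matrix.mulVec_smul, SimpleGraph.lapMatrix_mulVec_const_eq_zero, smul_zero]
  -- For disconnected graphs `x 0` need not be constant. This reflection sends `x 0` to the constant
  -- unit vector `u` and, as `x 0 - u` lies in both kernels, preserves all eigenvector relations.
  refine ⟨x.map (ℝ ∙ (x 0 - u))ᗮ.reflection, ⟨(√n)⁻¹, fun v => ?_⟩, fun i => ?_⟩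
  · rw [OrthonormalBasis.map_apply, Submodule.reflection_sub hnorm]
  · rw [OrthonormalBasis.map_apply]
    exact ⟨mulVec_reflection_eq (G.isSymm_lapMatrix ℝ)
        (hker G (by rw [(hx 0).1, hG0, zero_smul])) _ (hx i).1,
      mulVec_reflection_eq (H.isSymm_lapMatrix ℝ)
        (hker H (by rw [(hx 0).2, hH0, zero_smul])) _ (hx i).2⟩

theorem IsJointLaplacianSpectrum.exists_functionalCalculus {G H : SimpleGraph V}
    [DecidableRel G.Adj] [DecidableRel H.Adj] {n : ℕ} [NeZero n] {μG μH : Fin n → ℝ}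
    (hspec : IsJointLaplacianSpectrum G H μG μH) :
    ∃ φ : (Fin n → ℝ) →ₐ[ℝ] Matrix V V ℝ, (∀ f, (φ f).trace = ∑ i, f i) ∧ (∀ f, (φ f)ᵀ = φ f) ∧
      (Matrix.of fun _ _ => 1 : Matrix V V ℝ) = φ (Pi.single 0 (n : ℝ)) ∧
      G.lapMatrix ℝ = φ μG ∧ H.lapMatrix ℝ = φ μH := by
  obtain ⟨x, ⟨c, hc⟩, hx⟩ := hspec.exists_basis
  have h := x.columnMatrix_transpose_mul
  have h' := x.columnMatrix_mul_transpose
  have hcard : Fintype.card V = n := by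
    have := Module.finrank_eq_card_basis x.toBasis
    rwa [finrank_euclideanSpace, Fintype.card_fin] at this
  refine ⟨orthogonalCalculus x.columnMatrix h h', trace_orthogonalCalculus _ _ _,
    transpose_orthogonalCalculus _ _ _, ?_, eq_orthogonalCalculus _ _ _ fun i => (hx i).1,
    eq_orthogonalCalculus _ _ _ fun i => (hx i).2⟩
  have hc2 : c * n * c = 1 := by
    have := congrArg (fun N : Matrix (Fin n) (Fin n) ℝ => N 0 0) h
    simp only [Matrix.mul_apply, OrthonormalBasis.columnMatrix, Matrix.transpose_apply,
      Matrix.of_apply, hc, Finset.sum_const, Finset.card_univ, hcard, nsmul_eq_mul,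
      Matrix.one_apply_eq] at this
    linarith
  ext v w
  rw [orthogonalCalculus_apply, Matrix.mul_apply, Finset.sum_eq_single 0]
  · simp [OrthonormalBasis.columnMatrix, hc, Matrix.mul_diagonal, hc2]
  · intro i _ hi
    simp [Matrix.mul_diagonal, hi]
  · simp

end

/-! ### Existence of a joint spectrum -/

section

open Matrix Module.End

variable {V : Type*} [Fintype V] [DecidableEq V]

/-- Each eigenspace of `A` is invariant under `B`; diagonalize `B` inside it and collect the bases.
-/
theorem exists_joint_orthonormalBasis {A B : Matrix V V ℝ} (hA : A.IsSymm) (hB : B.IsSymm)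
    (hAB : Commute A B) {n : ℕ} (hn : Fintype.card V = n) :
    ∃ (x : OrthonormalBasis (Fin n) ℝ (EuclideanSpace ℝ V)) (a b : Fin n → ℝ), ∀ i,
      A *ᵥ (x i).ofLp = a i • (x i).ofLp ∧ B *ᵥ (x i).ofLp = b i • (x i).ofLp := by
  set T := toEuclideanLin (𝕜 := ℝ) A with hTdef
  set S := toEuclideanLin (𝕜 := ℝ) B with hSdef
  have hT : T.IsSymmetric := isSymmetric_toEuclideanLin_iff.2
    (by rw [IsHermitian, conjTranspose_eq_transpose_of_trivial, hA])
  have hS : S.IsSymmetric := isSymmetric_toEuclideanLin_iff.2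
    (by rw [IsHermitian, conjTranspose_eq_transpose_of_trivial, hB])
  have hTS (v : EuclideanSpace ℝ V) : T (S v) = S (T v) := by
    simp only [T, S, toLpLin_apply, mulVec_mulVec, hAB.eq]
  have hinv (μ : ℝ) : ∀ v ∈ eigenspace T μ, S v ∈ eigenspace T μ := by
    intro v hv
    rw [mem_eigenspace_iff] at hv ⊢
    rw [hTS, hv, map_smul]
  let y := hT.direct_sum_isInternal.collectedOrthonormalBasis hT.orthogonalFamily_eigenspaces'
    fun μ => (hS.restrict_invariant (hinv μ)).eigenvectorBasis rfl
  have hy (k) : ∃ a b : ℝ, A *ᵥ (y k).ofLp = a • (y k).ofLp ∧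
      B *ᵥ (y k).ofLp = b • (y k).ofLp := by
    obtain ⟨μ, j⟩ := k
    have hyk : y ⟨μ, j⟩ = ((hS.restrict_invariant (hinv μ)).eigenvectorBasis rfl j : _) := by
      simp [y, DirectSum.IsInternal.collectedOrthonormalBasis]
    refine ⟨μ, (hS.restrict_invariant (hinv μ)).eigenvalues rfl j, ?_, ?_⟩
    · have h1 := mem_eigenspace_iff.1
        ((hS.restrict_invariant (hinv μ)).eigenvectorBasis rfl j).2
      rw [← hyk] at h1
      exact congrArg WithLp.ofLp h1
    · have h1 := congrArg Subtype.val
        ((hS.restrict_invariant (hinv μ)).apply_eigenvectorBasis rfl j)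
      rw [LinearMap.coe_restrict_apply, Submodule.coe_smul, ← hyk] at h1
      exact congrArg WithLp.ofLp h1
  choose a b hab using hy
  have hc : Fintype.card (Σ μ : Eigenvalues T, Fin (Module.finrank ℝ (eigenspace T μ))) = n := by
    rw [← Module.finrank_eq_card_basis y.toBasis, finrank_euclideanSpace, hn]
  let e := Fintype.equivFinOfCardEq hc
  refine ⟨y.reindex e, a ∘ e.symm, b ∘ e.symm, fun i => ?_⟩
  rw [OrthonormalBasis.reindex_apply]
  exact hab _

namespace SimpleGraph

variable {G H : SimpleGraph V} [DecidableRel G.Adj] [DecidableRel H.Adj]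

/-- `H` need not be regular. Applying `A_G A_H = A_H A_G` to the all-ones vector puts the degree
vector of `H` in the kernel of `L(G)`, so degrees in `H` are constant along edges of `G` and `A_G`
commutes with the degree matrix of `H`. -/
theorem IsRegularOfDegree.lapMatrix_commute {r : ℕ} (hr : G.IsRegularOfDegree r)
    (h : Commute (G.adjMatrix ℝ) (H.adjMatrix ℝ)) :
    Commute (G.lapMatrix ℝ) (H.lapMatrix ℝ) := by
  have hdegG : G.degMatrix ℝ = (r : ℝ) • 1 := by
    ext u v
    simp [degMatrix, Matrix.diagonal_apply, Matrix.one_apply, hr u]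
  have hd : H.adjMatrix ℝ *ᵥ (fun _ => 1) = fun v => (H.degree v : ℝ) := by
    ext v; simp
  have hG1 : G.adjMatrix ℝ *ᵥ (fun _ => 1) = (r : ℝ) • fun _ => (1 : ℝ) := by
    ext v; simp [hr.degree_eq]
  have hker : G.lapMatrix ℝ *ᵥ (fun v => (H.degree v : ℝ)) = 0 := by
    rw [lapMatrix, hdegG, sub_mulVec, smul_mulVec, one_mulVec, ← hd, mulVec_mulVec, h.eq,
      ← mulVec_mulVec, hG1, mulVec_smul, sub_self]
  rw [lapMatrix_mulVec_eq_zero_iff_forall_adj] at hker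
  have hD : Commute (G.adjMatrix ℝ) (H.degMatrix ℝ) := by
    ext u v
    rw [degMatrix, mul_diagonal, diagonal_mul, adjMatrix_apply]
    split_ifs with huv
    · rw [hker u v huv, mul_comm]
    · simp
  rw [lapMatrix, lapMatrix, hdegG]
  exact ((Commute.one_left _).smul_left _).sub_left (hD.sub_right h)

end SimpleGraph

/-- Some basis vector is not orthogonal to the all-ones vector, which both Laplacians kill; by
symmetry both its eigenvalues are 0, and a swap moves it to index 0. -/
theorem exists_isJointLaplacianSpectrum {G H : SimpleGraph V} [DecidableRel G.Adj]
    [DecidableRel H.Adj] {n r : ℕ} [NeZero n] (hn : Fintype.card V = n)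
    (hr : G.IsRegularOfDegree r) (h : Commute (G.adjMatrix ℝ) (H.adjMatrix ℝ)) :
    ∃ μG μH : Fin n → ℝ, IsJointLaplacianSpectrum G H μG μH := by
  obtain ⟨x, a, b, hx⟩ := exists_joint_orthonormalBasis (G.isSymm_lapMatrix ℝ)
    (H.isSymm_lapMatrix ℝ) (hr.lapMatrix_commute h) hn
  have hne : Nonempty V := Fintype.card_pos_iff.1 (hn ▸ NeZero.pos n)
  set u : EuclideanSpace ℝ V := WithLp.toLp 2 fun _ => 1 with hu
  have hu0 : u ≠ 0 := fun h0 => by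
    have := congrArg (fun w : EuclideanSpace ℝ V => w hne.some) h0
    simp [hu] at this
  obtain ⟨k, hk⟩ : ∃ k, inner ℝ (x k) u ≠ 0 := by
    by_contra! hall
    exact hu0 (by rw [← x.sum_repr' u]; simp [hall])
  have hzero (Γ : SimpleGraph V) [DecidableRel Γ.Adj] {μ : ℝ}
      (hμ : Γ.lapMatrix ℝ *ᵥ (x k).ofLp = μ • (x k).ofLp) : μ = 0 := by
    have h1 : u.ofLp ⬝ᵥ (Γ.lapMatrix ℝ *ᵥ (x k).ofLp) = 0 := by
      rw [Matrix.dotProduct_mulVec, ← Matrix.mulVec_transpose, Γ.isSymm_lapMatrix ℝ, hu,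
        Γ.lapMatrix_mulVec_const_eq_zero, zero_dotProduct]
    rw [hμ, dotProduct_smul, smul_eq_mul] at h1
    refine (mul_eq_zero.1 h1).resolve_right fun h2 => hk ?_
    rw [PiLp.inner_apply, ← h2]
    simp [dotProduct]
  refine ⟨a ∘ Equiv.swap 0 k, b ∘ Equiv.swap 0 k, ?_, ?_, x.reindex (Equiv.swap 0 k), fun i => ?_⟩
  · simpa using hzero G (hx k).1
  · simpa using hzero H (hx k).2
  · rw [OrthonormalBasis.reindex_apply, Equiv.symm_swap]
    exact hx _

end

/-! ### The three formulas for regular graphs -/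

section

open Matrix

variable {V : Type*} [Fintype V] [DecidableEq V] {G H : SimpleGraph V} [DecidableRel G.Adj]
  [DecidableRel H.Adj] {n m r : ℕ} [NeZero n] {μG μH : Fin n → ℝ}

/-- The Kirchhoff index of a merged subdivision graph of a regular graph `G` whose new vertices are
joined by a graph with Laplacian matrix in the span of `1`, `J` and `Bᵀ * B`. -/
theorem IsJointLaplacianSpectrum.kirchhoffIndex_mergedSubdivision
    (hspec : IsJointLaplacianSpectrum G H μG μH) {H₂ : SimpleGraph G.edgeSet}
    [DecidableRel H₂.Adj] (hn : Fintype.card V = n) (hm : G.edgeFinset.card = m)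
    (hr : G.IsRegularOfDegree r) (hconn : (mergedSubdivision G H H₂).Connected)
    {α β γ : ℝ} (hα : 0 < α) (hγ : 0 ≤ γ) (h0 : α - β * m + 2 * r * γ = 2)
    (hC : (2 : ℝ) • 1 + H₂.lapMatrix ℝ = α • 1 - β • (Matrix.of fun _ _ => 1) +
      γ • (G.edgeIncMatrixᵀ * G.edgeIncMatrix)) :
    kirchhoffIndex (mergedSubdivision G H H₂) =
      (n : ℝ) / 2 + ((m : ℝ) ^ 2 - (n : ℝ) ^ 2) / α +
        ((m : ℝ) + n) * ∑ i ∈ Finset.univ.erase (0 : Fin n),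
          (α + γ * (2 * r - μG i) + (r + μH i)) /
            ((r + μH i) * (α + γ * (2 * r - μG i)) - (2 * r - μG i)) := by
  obtain ⟨φ, htr, hsymm, hJ, hG, hH⟩ := hspec.exists_functionalCalculus
  exact kirchhoffIndex_mergedSubdivision_of_functionalCalculus hn
    (by rw [← SimpleGraph.edgeFinset_card, hm]) hr hconn φ htr hsymm hJ hG hH hspec.1 hα hγ h0 hC

theorem IsJointLaplacianSpectrum.kirchhoffIndex_mergedSubdivision_bot
    (hspec : IsJointLaplacianSpectrum G H μG μH) (hn : Fintype.card V = n)
    (hm : G.edgeFinset.card = m) (hr : G.IsRegularOfDegree r)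
    (hconn : (mergedSubdivision G H ⊥).Connected) :
    kirchhoffIndex (mergedSubdivision G H ⊥) =
      (n : ℝ) / 2 + ((m : ℝ) ^ 2 - (n : ℝ) ^ 2) / 2 +
        ((m : ℝ) + n) * ∑ i ∈ Finset.univ.erase (0 : Fin n),
          (((r : ℝ) + 2) + μH i) / (2 * μH i + μG i) := by
  classical
  rw [hspec.kirchhoffIndex_mergedSubdivision hn hm hr hconn (α := 2) (β := 0) (γ := 0) two_pos
    le_rfl (by ring) (by rw [SimpleGraph.lapMatrix_bot]; simp)]
  congr 2
  refine Finset.sum_congr rfl fun i _ => ?_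
  congr 1 <;> ring

theorem IsJointLaplacianSpectrum.kirchhoffIndex_mergedSubdivision_top
    (hspec : IsJointLaplacianSpectrum G H μG μH) (hn : Fintype.card V = n)
    (hm : G.edgeFinset.card = m) (hr : G.IsRegularOfDegree r)
    (hconn : (mergedSubdivision G H ⊤).Connected) :
    kirchhoffIndex (mergedSubdivision G H ⊤) =
      (n : ℝ) / 2 + ((m : ℝ) ^ 2 - (n : ℝ) ^ 2) / ((m : ℝ) + 2) +
        ((m : ℝ) + n) * ∑ i ∈ Finset.univ.erase (0 : Fin n),
          ((m : ℝ) + (r + 2) + μH i) / (m * (r + μH i) + 2 * μH i + μG i) := by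
  classical
  have hm' : (Fintype.card G.edgeSet : ℝ) = m := by rw [← hm, SimpleGraph.edgeFinset_card]
  rw [hspec.kirchhoffIndex_mergedSubdivision hn hm hr hconn (α := m + 2) (β := 1) (γ := 0)
    (by positivity) le_rfl (by ring) (by
      rw [SimpleGraph.lapMatrix_top, hm', add_smul]
      simp only [one_smul, zero_smul]
      abel)]
  congr 2
  refine Finset.sum_congr rfl fun i _ => ?_
  congr 1 <;> ring

theorem IsJointLaplacianSpectrum.kirchhoffIndex_mergedSubdivision_compl_lineGraph
    (hspec : IsJointLaplacianSpectrum G H μG μH) (hn : Fintype.card V = n)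
    (hm : G.edgeFinset.card = m) (hr : G.IsRegularOfDegree r)
    (hconn : (mergedSubdivision G H G.lineGraphᶜ).Connected) :
    kirchhoffIndex (mergedSubdivision G H G.lineGraphᶜ) =
      (n : ℝ) / 2 + ((m : ℝ) ^ 2 - (n : ℝ) ^ 2) / ((m : ℝ) - 2 * r + 2) +
        ((m : ℝ) + n) * ∑ i ∈ Finset.univ.erase (0 : Fin n),
          ((m : ℝ) + (r + 2) + μH i - μG i) /
            ((m - μG i) * (r + μH i) + 2 * μH i + μG i) := by
  classical
  have hm' : (Fintype.card G.edgeSet : ℝ) = m := by rw [← hm, SimpleGraph.edgeFinset_card]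
  -- From `2 m = n r ≥ r (r + 1)` one gets `2 (m - 2 r + 2) ≥ r² - 3 r + 4`, and `4 (r² - 3 r + 4) =
  -- (2 r - 3)² + 7`.
  have hpos : (0 : ℝ) < m - 2 * r + 2 := by
    have h1 := hr.card_mul_degree
    rw [hn, hm] at h1
    obtain ⟨v⟩ : Nonempty V := Fintype.card_pos_iff.1 (hn ▸ NeZero.pos n)
    have h2 : r < n := by rw [← hn, ← hr v]; exact G.degree_lt_card_verts v
    have h1' : (n : ℝ) * r = 2 * m := by exact_mod_cast h1
    have h2' : (r : ℝ) + 1 ≤ n := by exact_mod_cast h2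
    nlinarith [mul_le_mul_of_nonneg_right h2' (Nat.cast_nonneg (α := ℝ) r),
      sq_nonneg (2 * (r : ℝ) - 3)]
  rw [hspec.kirchhoffIndex_mergedSubdivision hn hm hr hconn (α := m - 2 * r + 2) (β := 1) (γ := 1)
    hpos zero_le_one (by ring) (by
      rw [SimpleGraph.lapMatrix_compl, hr.lapMatrix_lineGraph, hm', add_smul, sub_smul]
      simp only [one_smul]
      abel)]
  congr 2
  refine Finset.sum_congr rfl fun i _ => ?_
  congr 1 <;> ring

end

/-! ### The star -/

section Star

open Matrix

/-- The inverse of `1 + L(H)` and its trace. -/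
theorem exists_inverse_one_add_lapMatrix {W : Type*} [Fintype W] [DecidableEq W]
    (H : SimpleGraph W) [DecidableRel H.Adj] {m : ℕ} {μ : Fin m → ℝ}
    (hμ : (H.lapMatrix ℝ).charpoly = ∏ i, (Polynomial.X - Polynomial.C (μ i))) :
    ∃ K : Matrix W W ℝ, (1 + H.lapMatrix ℝ) * K = 1 ∧ K.trace = ∑ i, (μ i + 1)⁻¹ ∧
      ∀ i, 0 ≤ μ i := by
  have hherm := H.isHermitian_lapMatrix (R := ℝ)
  set lam := hherm.eigenvalues with hlam
  have hpos (i : W) : 0 ≤ lam i := (SimpleGraph.posSemidef_lapMatrix ℝ H).eigenvalues_nonneg i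
  have h := hherm.eigenvectorBasis.columnMatrix_transpose_mul
  have h' := hherm.eigenvectorBasis.columnMatrix_mul_transpose
  set φ := orthogonalCalculus hherm.eigenvectorBasis.columnMatrix h h'
  have hL : H.lapMatrix ℝ = φ lam :=
    eq_orthogonalCalculus _ _ _ fun i => hherm.mulVec_eigenvectorBasis i
  -- `lam` and `μ` have different index types, so they are compared as root multisets of the
  -- characteristic polynomial.
  have hroots : Multiset.map lam Finset.univ.val = Multiset.map μ Finset.univ.val := by
    have h1 := hherm.roots_charpoly_eq_eigenvalues
    have h2 : ∏ i, (Polynomial.X - Polynomial.C (μ i)) =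
        ((Multiset.map μ Finset.univ.val).map fun t => Polynomial.X - Polynomial.C t).prod := by
      rw [Multiset.map_map]; rfl
    rw [hμ, h2, Polynomial.roots_multiset_prod_X_sub_C] at h1
    exact h1.symm
  have hmul : (1 + lam) * (fun i => (lam i + 1)⁻¹) = 1 := by
    ext i
    have := hpos i
    simp only [Pi.mul_apply, Pi.add_apply, Pi.one_apply]
    rw [add_comm, mul_inv_cancel₀ (by positivity)]
  refine ⟨φ fun i => (lam i + 1)⁻¹, ?_, ?_, fun i => ?_⟩
  · rw [hL, ← map_one φ, ← map_add, ← map_mul, hmul]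
  · rw [trace_orthogonalCalculus]
    have := congrArg (fun s : Multiset ℝ => (s.map fun t => (t + 1)⁻¹).sum) hroots
    simp only [Multiset.map_map] at this
    exact this
  · have : μ i ∈ Multiset.map lam Finset.univ.val :=
      hroots ▸ Multiset.mem_map_of_mem μ (Finset.mem_univ_val i)
    obtain ⟨j, -, hj⟩ := Multiset.mem_map.1 this
    exact hj ▸ hpos j

theorem SimpleGraph.lapMatrix_comap_equiv {W U : Type*} [Fintype W] [DecidableEq W] [Fintype U]
    [DecidableEq U] (H : SimpleGraph U) [DecidableRel H.Adj] (e : W ≃ U)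
    [DecidableRel (H.comap e).Adj] :
    (H.comap e).lapMatrix ℝ = Matrix.reindex e.symm e.symm (H.lapMatrix ℝ) := by
  ext u v
  have hadj (u v : W) : (if (H.comap e).Adj u v then (1 : ℝ) else 0) =
      if H.Adj (e u) (e v) then 1 else 0 := by simp
  simp only [lapMatrix_apply, reindex_apply, submatrix_apply, Equiv.symm_symm, hadj,
    degree_eq_sum_if_adj, e.apply_eq_iff_eq]
  rw [Equiv.sum_comp e fun w => if H.Adj (e u) w then (1 : ℝ) else 0]

theorem SimpleGraph.inl_mem_of_mem_edgeSet_completeBipartiteGraph {m : ℕ}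
    (e : (completeBipartiteGraph (Fin 1) (Fin m)).edgeSet) :
    Sum.inl 0 ∈ (e : Sym2 (Fin 1 ⊕ Fin m)) := by
  obtain ⟨e, he⟩ := e
  induction e with | _ a b =>
  rw [mem_edgeSet] at he
  rcases a with a | a <;> rcases b with b | b <;> simp_all [Subsingleton.elim _ (0 : Fin 1)]

theorem mergedSubdivision_star_connected {m : ℕ}
    (H₂ : SimpleGraph (completeBipartiteGraph (Fin 1) (Fin m)).edgeSet) :
    (mergedSubdivision (completeBipartiteGraph (Fin 1) (Fin m)) ⊥ H₂).Connected := by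
  have hedge (e : (completeBipartiteGraph (Fin 1) (Fin m)).edgeSet) :
      (mergedSubdivision _ ⊥ H₂).Reachable (.inl (.inl 0)) (.inr e) :=
    SimpleGraph.Adj.reachable (SimpleGraph.inl_mem_of_mem_edgeSet_completeBipartiteGraph e)
  rw [SimpleGraph.connected_iff_exists_forall_reachable]
  refine ⟨.inl (.inl 0), ?_⟩
  rintro ((v | j) | e)
  · rw [Subsingleton.elim v 0]
  · have hj : s(Sum.inl 0, Sum.inr j) ∈ (completeBipartiteGraph (Fin 1) (Fin m)).edgeSet := by
      simp
    refine (hedge ⟨_, hj⟩).trans (SimpleGraph.Adj.reachable ?_)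
    change Sum.inr j ∈ s(Sum.inl 0, Sum.inr j)
    simp
  · exact hedge e

section

variable {V W : Type*} [Fintype V] [DecidableEq V] [Fintype W] [DecidableEq W]

/-- A generalized inverse of a Laplacian matrix, obtained by grounding the vertices in the support
of `c`; `l` is the indicator function of the remaining old vertices. -/
theorem fromBlocks_grounded_mul {D : Matrix V V ℝ} {B Z : Matrix V W ℝ} {L K : Matrix W W ℝ}
    {c l : V → ℝ} (hBZ : B = Z + vecMulVec c 1) (hDl : D * diagonal l = diagonal l)
    (hDZ : D * Z = Z) (hBZ1 : Bᵀ * Z = 1) (hBl : Bᵀ * diagonal l = Zᵀ) (hK : (1 + L) * K = 1)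
    (hK1 : 1 ᵥ* K = 1) (hZrow : 1 ᵥ* Zᵀ = l) (hlc : diagonal l + diagonal c = 1)
    (hcl : vecMulVec c 1 = vecMulVec c l + diagonal c) :
    fromBlocks D (-B) (-Bᵀ) ((2 : ℝ) • 1 + L) *
      fromBlocks (diagonal l + Z * K * Zᵀ) (Z * K) (K * Zᵀ) K =
        1 - vecMulVec (Sum.elim c 0) 1 := by
  have hrhs : (vecMulVec (Sum.elim c (0 : W → ℝ)) 1 : Matrix (V ⊕ W) (V ⊕ W) ℝ) =
      fromBlocks (vecMulVec c 1) (vecMulVec c 1) 0 0 := by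
    ext (i | i) (j | j) <;> simp [vecMulVec_apply]
  have hBK : B * K = Z * K + vecMulVec c 1 := by
    conv_lhs => rw [hBZ]
    rw [Matrix.add_mul, vecMulVec_mul, hK1]
  have hW : (2 : ℝ) • 1 + L = 1 + (1 + L) := by rw [two_smul, add_assoc]
  rw [hrhs, fromBlocks_multiply, ← fromBlocks_one, sub_eq_add_neg, fromBlocks_neg, fromBlocks_add,
    hW]
  congr 1
  · rw [Matrix.mul_add, hDl, Matrix.mul_assoc Z, ← Matrix.mul_assoc D, hDZ,
      Matrix.neg_mul, ← Matrix.mul_assoc B, hBK, Matrix.add_mul, vecMulVec_mul, hZrow, hcl,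
      ← hlc, Matrix.mul_assoc]
    abel
  · rw [← Matrix.mul_assoc, hDZ, Matrix.neg_mul, hBK]
    abel
  · rw [Matrix.neg_mul, Matrix.mul_add, hBl, Matrix.mul_assoc Z, ← Matrix.mul_assoc Bᵀ, hBZ1,
      Matrix.one_mul, Matrix.add_mul, Matrix.one_mul, ← Matrix.mul_assoc (1 + L), hK,
      Matrix.one_mul]
    abel
  · rw [Matrix.neg_mul, ← Matrix.mul_assoc, hBZ1, Matrix.one_mul, Matrix.add_mul, Matrix.one_mul,
      hK]
    abel

theorem trace_fromBlocks_grounded {Z : Matrix V W ℝ} {K : Matrix W W ℝ} {l : V → ℝ}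
    (hZZ : Zᵀ * Z = 1) :
    (fromBlocks (diagonal l + Z * K * Zᵀ) (Z * K) (K * Zᵀ) K).trace = ∑ v, l v + 2 * K.trace := by
  have h1 : (fromBlocks (diagonal l + Z * K * Zᵀ) (Z * K) (K * Zᵀ) K).trace =
      (diagonal l + Z * K * Zᵀ).trace + K.trace := by
    simp [Matrix.trace, Fintype.sum_sum_type]
  rw [h1, trace_add, trace_diagonal, Matrix.trace_mul_comm, ← Matrix.mul_assoc, hZZ,
    Matrix.one_mul]
  ring

omit [DecidableEq V] [DecidableEq W] in
theorem sum_sum_eq_vecMul_dotProduct (N : Matrix V W ℝ) :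
    ∑ i, ∑ j, N i j = (1 ᵥ* N) ⬝ᵥ 1 := by
  simp only [vecMul, dotProduct, Pi.one_apply, one_mul, mul_one]
  exact Finset.sum_comm

-- `Z` and `K` preserve the all-ones row vector, so each of the four blocks containing `K` sums to
-- `Fintype.card W`.
omit [DecidableEq W] in
theorem sum_fromBlocks_grounded {Z : Matrix V W ℝ} {K : Matrix W W ℝ} {l : V → ℝ}
    (hZcol : ∀ f, ∑ v, Z v f = 1) (hK1 : 1 ᵥ* K = 1) :
    ∑ a, ∑ b, fromBlocks (diagonal l + Z * K * Zᵀ) (Z * K) (K * Zᵀ) K a b =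
      ∑ v, l v + 4 * Fintype.card W := by
  have hone : (1 : V → ℝ) ᵥ* Z = 1 := by
    ext f
    simp [vecMul, dotProduct, hZcol]
  have hone' : Zᵀ *ᵥ (1 : V → ℝ) = 1 := by rw [mulVec_transpose, hone]
  have hcardW : (1 : W → ℝ) ⬝ᵥ 1 = Fintype.card W := by simp [dotProduct]
  have hl : ∑ i, ∑ j, diagonal l i j = ∑ i, l i :=
    Finset.sum_congr rfl fun i _ => by simp [diagonal_apply]
  simp only [Fintype.sum_sum_type, fromBlocks_apply₁₁, fromBlocks_apply₁₂, fromBlocks_apply₂₁,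
    fromBlocks_apply₂₂, Finset.sum_add_distrib, Matrix.add_apply]
  rw [hl, sum_sum_eq_vecMul_dotProduct (Z * K * Zᵀ), sum_sum_eq_vecMul_dotProduct (Z * K),
    sum_sum_eq_vecMul_dotProduct (K * Zᵀ), sum_sum_eq_vecMul_dotProduct K]
  simp only [← vecMul_vecMul, hone, hK1, ← dotProduct_mulVec, hone', hcardW]
  ring

end

/-- The Kirchhoff index of `[S(G)]_H` for a star `G`. -/
theorem kirchhoffIndex_mergedSubdivision_of_star {m : ℕ} [NeZero m]
    {G : SimpleGraph (Fin 1 ⊕ Fin m)} [DecidableRel G.Adj] [Fintype G.edgeSet]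
    (hmem : ∀ e : G.edgeSet, Sum.inl 0 ∈ (e : Sym2 (Fin 1 ⊕ Fin m)))
    (hdeg : ∀ j : Fin m, (G.degree (.inr j) : ℝ) = 1) (hcard : Fintype.card G.edgeSet = m)
    (H : SimpleGraph G.edgeSet) [DecidableRel H.Adj] (hconn : (mergedSubdivision G ⊥ H).Connected)
    {μ : Fin m → ℝ} (hμ0 : μ 0 = 0)
    (hcharpoly : (H.lapMatrix ℝ).charpoly = ∏ i, (Polynomial.X - Polynomial.C (μ i))) :
    kirchhoffIndex (mergedSubdivision G ⊥ H) =
      (m : ℝ) + 3 + (2 * (m : ℝ) + 1) * ∑ j ∈ Finset.univ.erase (0 : Fin m),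
        (μ j + 3) / (μ j + 1) := by
  classical
  obtain ⟨K, hK, hKtr, hμ⟩ := exists_inverse_one_add_lapMatrix H hcharpoly
  set L := H.lapMatrix ℝ with hL
  set B := G.edgeIncMatrix with hBdef
  have hBc (f : G.edgeSet) : B (.inl 0) f = 1 := if_pos (hmem f)
  set c : Fin 1 ⊕ Fin m → ℝ := Sum.elim 1 0 with hc
  set l : Fin 1 ⊕ Fin m → ℝ := Sum.elim 0 1 with hl
  -- `c` and `l` indicate the centre and the leaves; `Z` is `B` with the centre's row erased.
  set Z : Matrix (Fin 1 ⊕ Fin m) G.edgeSet ℝ := diagonal l * B with hZ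
  have hBZ : B = Z + vecMulVec c 1 := by
    ext (v | j) f
    · rw [Subsingleton.elim v 0]
      simp [hZ, hc, hl, hBc]
    · simp [hZ, hc, hl]
  have hDl : G.degMatrix ℝ * diagonal l = diagonal l := by
    rw [SimpleGraph.degMatrix, diagonal_mul_diagonal]
    congr 1
    ext (v | j) <;> simp [hl, hdeg]
  have hDZ : G.degMatrix ℝ * Z = Z := by rw [hZ, ← Matrix.mul_assoc, hDl]
  have hll : diagonal l * diagonal l = diagonal l := by
    rw [diagonal_mul_diagonal]
    congr 1
    ext (v | j) <;> simp [hl]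
  -- Any two edges of the star meet, so `Bᵀ * B = 1 + J`; erasing the centre's row removes exactly
  -- `J`.
  have hBZ1 : Bᵀ * Z = 1 := by
    have h1 : Bᵀ * B = 1 + Matrix.of fun _ _ => 1 := by
      rw [SimpleGraph.edgeIncMatrix_transpose_mul_self]
      ext f g
      simp only [Matrix.add_apply, Matrix.smul_apply, Matrix.one_apply, SimpleGraph.adjMatrix_apply,
        Matrix.of_apply]
      have : G.lineGraph.Adj f g ↔ f ≠ g := ⟨fun h => h.1, fun h => ⟨h, _, hmem f, hmem g⟩⟩
      by_cases hfg : f = g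
      · subst hfg; simp; norm_num
      · simp [hfg, this]
    have h2 : Bᵀ * vecMulVec c (1 : G.edgeSet → ℝ) = Matrix.of fun _ _ => 1 := by
      ext f g
      simp [Matrix.mul_apply, hc, hBc, Fintype.sum_sum_type]
    have h3 : Bᵀ * Z = Bᵀ * B - Bᵀ * vecMulVec c 1 := by
      rw [← Matrix.mul_sub]
      congr 1
      rw [eq_sub_iff_add_eq, ← hBZ]
    rw [h3, h1, h2, add_sub_cancel_right]
  have hBl : Bᵀ * diagonal l = Zᵀ := by rw [hZ, transpose_mul, diagonal_transpose]
  have hZZ : Zᵀ * Z = 1 := by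
    rw [← hBl, Matrix.mul_assoc, hZ, ← Matrix.mul_assoc (diagonal l), hll]
    exact hBZ1
  have hLsymm : (1 + L)ᵀ = 1 + L := by
    rw [transpose_add, transpose_one, hL, H.isSymm_lapMatrix ℝ]
  have hL1 : (1 + L) *ᵥ 1 = 1 := by
    have : L *ᵥ 1 = 0 := H.lapMatrix_mulVec_const_eq_zero
    rw [add_mulVec, one_mulVec, this, add_zero]
  have hK1 : 1 ᵥ* K = 1 := by
    have h1 : 1 ᵥ* (1 + L) = 1 := by rw [← mulVec_transpose, hLsymm, hL1]
    rw [← h1, vecMul_vecMul, hK, h1, vecMul_one]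
  have hZrow : 1 ᵥ* Zᵀ = l := by
    rw [vecMul_transpose]
    ext (v | j)
    · simp [hZ, hl, mulVec, dotProduct]
    · simp only [hZ, hl, mulVec, dotProduct, diagonal_mul, Sum.elim_inr, Pi.one_apply, one_mul,
        mul_one]
      rw [G.sum_edgeIncMatrix_right, hdeg]
  have hZcol (f : G.edgeSet) : ∑ v, Z v f = 1 := by
    have h1 := G.sum_edgeIncMatrix_left f
    rw [← hBdef, Fintype.sum_sum_type] at h1
    simp [hBc] at h1
    simp [hZ, hl, Fintype.sum_sum_type]
    linarith
  -- The difference is `c cᵀ`, which is diagonal because a single vertex is grounded.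
  have hcl : vecMulVec c 1 = vecMulVec c l + diagonal c := by
    ext (i | i) (j | j)
    · rw [Subsingleton.elim i 0, Subsingleton.elim j 0]; simp [vecMulVec_apply, hc, hl]
    all_goals simp [vecMulVec_apply, hc, hl, diagonal_apply]
  have hlc : diagonal l + diagonal c = 1 := by
    rw [diagonal_add, ← diagonal_one]
    congr 1
    ext (i | i) <;> simp [hc, hl]
  have hinv : (mergedSubdivision G ⊥ H).lapMatrix ℝ *
      fromBlocks (diagonal l + Z * K * Zᵀ) (Z * K) (K * Zᵀ) K =
        1 - vecMulVec (Sum.elim c 0) 1 := by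
    rw [SimpleGraph.lapMatrix_mergedSubdivision, SimpleGraph.lapMatrix_bot, add_zero]
    exact fromBlocks_grounded_mul hBZ hDl hDZ hBZ1 hBl hK hK1 hZrow hlc hcl
  have hltr : ∑ v, l v = m := by simp [hl, Fintype.sum_sum_type]
  -- The trace is `m + 2 ∑ 1/(μ j + 1)`, the entry sum is `5 m`, and `μ 0 = 0` contributes 2 to the
  -- trace.
  rw [kirchhoffIndex_eq_of_lapMatrix_mul hconn _ _ hinv, trace_fromBlocks_grounded hZZ,
    sum_fromBlocks_grounded hZcol hK1, hltr, hKtr, Fintype.card_sum,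
    Fintype.card_sum, Fintype.card_fin, Fintype.card_fin, hcard,
    ← Finset.add_sum_erase _ _ (Finset.mem_univ (0 : Fin m)), hμ0]
  have hterm : ∀ j ∈ Finset.univ.erase (0 : Fin m),
      (μ j + 3) / (μ j + 1) = 1 + 2 * (μ j + 1)⁻¹ := by
    intro j _
    have : μ j + 1 ≠ 0 := by have := hμ j; positivity
    field_simp
    ring
  rw [Finset.sum_congr rfl hterm, Finset.sum_add_distrib, ← Finset.mul_sum]
  simp only [Finset.sum_const, Finset.card_erase_of_mem (Finset.mem_univ _), Finset.card_univ,
    Fintype.card_fin, nsmul_eq_mul, Nat.cast_pred (NeZero.pos m)]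
  push_cast
  ring

theorem kirchhoffIndex_mergedSubdivision_star {m : ℕ} [NeZero m] (H : SimpleGraph (Fin m))
    [DecidableRel H.Adj] [Fintype (completeBipartiteGraph (Fin 1) (Fin m)).edgeSet]
    (e : (completeBipartiteGraph (Fin 1) (Fin m)).edgeSet ≃ Fin m) {μ : Fin m → ℝ}
    (hspec : IsLaplacianSpectrum H μ) :
    kirchhoffIndex (mergedSubdivision (completeBipartiteGraph (Fin 1) (Fin m)) ⊥ (H.comap e)) =
      (m : ℝ) + 3 + (2 * (m : ℝ) + 1) * ∑ j ∈ Finset.univ.erase (0 : Fin m),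
        (μ j + 3) / (μ j + 1) := by
  classical
  refine kirchhoffIndex_mergedSubdivision_of_star
    SimpleGraph.inl_mem_of_mem_edgeSet_completeBipartiteGraph (fun j => ?_)
    (by simpa using Fintype.card_congr e) _ (mergedSubdivision_star_connected _) hspec.1 ?_
  · rw [SimpleGraph.degree_eq_sum_if_adj, Fintype.sum_sum_type]
    simp
  · rw [SimpleGraph.lapMatrix_comap_equiv, Matrix.charpoly_reindex]
    exact hspec.2

end Star

theorem mainTheorem11 :
    -- The families built on a regular graph `G` and a graph `H` commuting with `G`.
    (∀ {V : Type*} [Fintype V] [DecidableEq V] (G H : SimpleGraph V)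
      [DecidableRel G.Adj] [DecidableRel H.Adj] (n m r : ℕ) [NeZero n],
      Fintype.card V = n → G.edgeFinset.card = m → G.IsRegularOfDegree r →
      Commute (G.adjMatrix ℝ) (H.adjMatrix ℝ) →
      (∃ μG μH : Fin n → ℝ, IsJointLaplacianSpectrum G H μG μH) ∧
      ∀ μG μH : Fin n → ℝ, IsJointLaplacianSpectrum G H μG μH →
        ((mergedSubdivision G H ⊥).Connected →
          kirchhoffIndex (mergedSubdivision G H ⊥) =
            (n : ℝ) / 2 + ((m : ℝ) ^ 2 - (n : ℝ) ^ 2) / 2 +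
              ((m : ℝ) + n) * ∑ i ∈ Finset.univ.erase (0 : Fin n),
                (((r : ℝ) + 2) + μH i) / (2 * μH i + μG i)) ∧
        ((mergedSubdivision G H ⊤).Connected →
          kirchhoffIndex (mergedSubdivision G H ⊤) =
            (n : ℝ) / 2 + ((m : ℝ) ^ 2 - (n : ℝ) ^ 2) / ((m : ℝ) + 2) +
              ((m : ℝ) + n) * ∑ i ∈ Finset.univ.erase (0 : Fin n),
                ((m : ℝ) + (r + 2) + μH i) / (m * (r + μH i) + 2 * μH i + μG i)) ∧
        ((mergedSubdivision G H G.lineGraphᶜ).Connected →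
          kirchhoffIndex (mergedSubdivision G H G.lineGraphᶜ) =
            (n : ℝ) / 2 + ((m : ℝ) ^ 2 - (n : ℝ) ^ 2) / ((m : ℝ) - 2 * r + 2) +
              ((m : ℝ) + n) * ∑ i ∈ Finset.univ.erase (0 : Fin n),
                ((m : ℝ) + (r + 2) + μH i - μG i) /
                  ((m - μG i) * (r + μH i) + 2 * μH i + μG i))) ∧
    -- The star `K_{1,m}`, its `m` edges being labelled by the vertices of `H` in any way.
    (∀ (m : ℕ) [NeZero m] (H : SimpleGraph (Fin m)) [DecidableRel H.Adj]
      [Fintype (completeBipartiteGraph (Fin 1) (Fin m)).edgeSet]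
      (e : (completeBipartiteGraph (Fin 1) (Fin m)).edgeSet ≃ Fin m) (μ : Fin m → ℝ),
      IsLaplacianSpectrum H μ →
        kirchhoffIndex (mergedSubdivision (completeBipartiteGraph (Fin 1) (Fin m)) ⊥ (H.comap e)) =
          (m : ℝ) + 3 + (2 * (m : ℝ) + 1) * ∑ j ∈ Finset.univ.erase (0 : Fin m),
            (μ j + 3) / (μ j + 1)) := by
  refine ⟨fun G H _ _ n m r _ hn hm hr hcomm => ?_, fun m _ H _ _ e μ hspec =>
    kirchhoffIndex_mergedSubdivision_star H e hspec⟩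
  exact ⟨exists_isJointLaplacianSpectrum hn hr hcomm, fun μG μH hspec =>
    ⟨hspec.kirchhoffIndex_mergedSubdivision_bot hn hm hr,
      hspec.kirchhoffIndex_mergedSubdivision_top hn hm hr,
      hspec.kirchhoffIndex_mergedSubdivision_compl_lineGraph hn hm hr⟩⟩
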